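/- Let $(X,P)$ be a probability space, let $\varphi_t:X\to X$ ($t\in\mathbb R$) be measurable maps, let $d\ge 1$, and let $g:X\to\mathbb R^d$ be bounded and measurable. On $X^n$ with the product measure $P_n=P^n$ put $$G_n(x_1,\dots,x_n)=\frac1n\sum_{i=1}^n g(x_i),\qquad \Phi_{n,t}(x_1,\dots,x_n)=(\varphi_t(x_1),\dots,\varphi_t(x_n)),\qquad G_{n,t}=G_n\circ\Phi_{n,t}.$$ Fix $t$. For $\lambda_1,\lambda_2\in\mathbb R^d$ (row vectors) define the dynamic free energy $$\Psi_t(\lambda_1,\lambda_2)=\lim_{n\to\infty}\frac1n\log\int_{X^n} e^{n[\lambda_1G_n+\lambda_2G_{n,t}]}\,dP_n,$$ and write $\Psi(\lambda)=\Psi_t(\lambda,0)$, $Z(\lambda)=\int e^{\lambda g}\,dP$. For $a_0=\nabla\Psi(\lambda_0)$ put $\psi_t(a_0)=\nabla_2\Psi_t(\lambda_0,0)$. Then: 1. All the exponentials above and $e^{\lambda_1g+\lambda_2 g\circ\varphi_t}$ are integrable, the limit $\Psi_t$ exists and is finite everywhere, and $$\Psi_t(\lambda_1,\lambda_2)=\log\int_X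 e^{\lambda_1g(x)+\lambda_2g(\varphi_t(x))}\,dP(x).$$ 2. $\Psi_t$ is differentiable on $\mathbb R^d\times\mathbb R^d$. 3. The laws of $(G_n,G_{n,t})$ under $P_n$ satisfy the large deviation principle (LDP) on $\mathbb R^d\times\mathbb R^d$ with speed $n$ and with the good convex rate function $$I_t(a_1,a_2)=\sup_{\lambda_1,\lambda_2}[\lambda_1a_1+\lambda_2a_2-\Psi_t(\lambda_1,\lambda_2)]\in[0,\infty],$$ and $I_t(a_1,a_2)=\lambda_1a_1+\lambda_2a_2-\Psi_t(\lambda_1,\lambda_2)$ whenever $(a_1,a_2)=\nabla\Psi_t(\lambda_1,\lambda_2)$. 4. Let $\lambda_0\in\mathbb R^d$ and $a_0=\nabla\Psi(\lambda_0)$. The value $\psi_t(a_0)$ does not depend on the choice of such a $\lambda_0$, and $$a_0=\frac{\int_X g\,e^{\lambda_0g}\,dP}{\int_X e^{\lambda_0g}\,dP}=\lim_{n\to\infty}\frac{\int G_n e^{n\lambda_0G_n}\,dP_n}{\int e^{n\lambda_0G_n}\,dP_n},\qquad \psi_t(a_0)=\frac{\int_X (g\circ\varphi_t)\,e^{\lambda_0g}\,dP}{\int_X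 e^{\lambda_0g}\,dP}=\lim_{n\to\infty}\frac{\int G_{n,t} e^{n\lambda_0G_n}\,dP_n}{\int e^{n\lambda_0G_n}\,dP_n}.$$ Let $B_0=\{a_1\in\mathbb R^d:\lambda_0(a_1-a_0)\ge0\}\times\mathbb R^d$. Then $P_n[(G_n,G_{n,t})\in B_0]>0$ for all $n\ge1$, $\inf I_t(B_0)=\lambda_0a_0-\Psi(\lambda_0)$, and the laws of $(G_n,G_{n,t})$ conditioned on $(G_n,G_{n,t})\in B_0$ satisfy the LDP with speed $n$ and the good convex rate function equal to $I_t-\inf I_t(B_0)$ on $\overline{B_0}$ and to $\infty$ elsewhere. The only zero of this rate function is $(a_0,\psi_t(a_0))$, and for every Borel set $B$, $$\lim_{n\to\infty}P_n[(G_n,G_{n,t})\in B\mid (G_n,G_{n,t})\in B_0]=\begin{cases}1&\text{if }(a_0,\psi_t(a_0))\in\operatorname{int}B,\\0&\text{if }(a_0,\psi_t(a_0))\notin\overline B.\end{cases}$$ 5. The map $\lambda\mapsto\nabla\Psi(\lambda)$ is differentiable, and its Jacobian matrix is $$J(\lambda)=\frac{\int g g^{\mathsf T}e^{\lambda g}\,dP}{\int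 e^{\lambda g}\,dP}-\frac{\int g\,e^{\lambda g}\,dP\int g^{\mathsf T}e^{\lambda g}\,dP}{\left(\int e^{\lambda g}\,dP\right)^2},$$ the covariance matrix of $g$ under the canonical distribution $Z(\lambda)^{-1}e^{\lambda g}\,dP$. If $\det J(\lambda)\ne0$ for some $\lambda$, then $\lambda\mapsto\nabla\Psi(\lambda)$ is injective on $\mathbb R^d$. If $g$ is almost everywhere constant, then $J\equiv0$ and this map is not injective. 6. If $d=1$ and $g=1_C$ for a measurable $C\subseteq X$, then $$J(\lambda)=\frac{e^{\lambda}P(C)[1-P(C)]}{[1-P(C)+e^{\lambda}P(C)]^2},$$ which is zero if and only if $P(C)\in\{0,1\}$. In that case $g$ is almost everywhere constant; otherwise $\lambda\mapsto\nabla\Psi(\lambda)$ is injective. -/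

import Mathlib

open MeasureTheory ProbabilityTheory Filter Topology

noncomputable section

/-- The space `ℝ^d` of macrostates, and of conjugate macrostates (row vectors `l`, acting on
column vectors `a` by `l a = inner ℝ l a`). -/
abbrev MacroSpace (d : ℕ) : Type := EuclideanSpace ℝ (Fin d)

/-! ### Large deviation principles -/

/-- The large deviation principle, with speed `v n`, for the Borel measures `μ n`, with rate function
`I`: `I` is nonnegative and lower semicontinuous, and for every Borel set `A`
`-inf I(int A) ≤ liminf (v n)⁻¹ log (μ n A) ≤ limsup (v n)⁻¹ log (μ n A) ≤ -inf I(cl A)`. -/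
structure SatisfiesLDP {Y : Type*} [TopologicalSpace Y] [MeasurableSpace Y]
    (v : ℕ → ℝ) (μ : ℕ → Measure Y) (I : Y → EReal) : Prop where
  nonneg : ∀ y, 0 ≤ I y
  lsc : LowerSemicontinuous I
  lower : ∀ A : Set Y, MeasurableSet A →
    -(⨅ y ∈ interior A, I y) ≤
      liminf (fun n => (((v n)⁻¹ : ℝ) : EReal) * ENNReal.log (μ n A)) atTop
  upper : ∀ A : Set Y, MeasurableSet A →
    limsup (fun n => (((v n)⁻¹ : ℝ) : EReal) * ENNReal.log (μ n A)) atTop ≤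
      -(⨅ y ∈ closure A, I y)

/-- A rate function is good if its level sets are compact. -/
def IsGoodRate {Y : Type*} [TopologicalSpace Y] (I : Y → EReal) : Prop :=
  ∀ α : ℝ, IsCompact {y | I y ≤ (α : EReal)}

/-- Convexity of an extended-real-valued function: its epigraph is convex. -/
def IsConvexRate {Y : Type*} [AddCommGroup Y] [Module ℝ Y] (I : Y → EReal) : Prop :=
  Convex ℝ {p : Y × ℝ | I p.1 ≤ (p.2 : EReal)}

open Classical in
/-- The rate function obtained from `I` by conditioning on `B`: `I - inf I(B)` on the closure of
`B`, and `∞` elsewhere. -/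
def conditionalRate {Y : Type*} [TopologicalSpace Y] (I : Y → EReal) (B : Set Y) (y : Y) : EReal :=
  if y ∈ closure B then I y - ⨅ z ∈ B, I z else ⊤

/-! ### The dynamic free energy and the objects derived from it -/

/-- `∫ exp (v_n [l₁ G_{n,0} + l₂ G_{n,t}]) dP_n`, where `G₀ n` is `G_{n,0}` and `G₁ n` is
`G_{n,t}`. -/
def dynamicPartition {d : ℕ} {Ω : ℕ → Type*} [∀ n, MeasurableSpace (Ω n)] (v : ℕ → ℝ)
    (P : ∀ n, Measure (Ω n)) (G₀ G₁ : ∀ n, Ω n → MacroSpace d) (l₁ l₂ : MacroSpace d) (n : ℕ) : ℝ :=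
  ∫ x, Real.exp (v n * (inner ℝ l₁ (G₀ n x) + inner ℝ l₂ (G₁ n x))) ∂(P n)

/-- The dynamic free energy `lim v_n⁻¹ log ∫ exp (v_n [l₁ G_{n,0} + l₂ G_{n,t}]) dP_n`
(meaningful only where this limit exists). -/
def dynamicFreeEnergy {d : ℕ} {Ω : ℕ → Type*} [∀ n, MeasurableSpace (Ω n)] (v : ℕ → ℝ)
    (P : ∀ n, Measure (Ω n)) (G₀ G₁ : ∀ n, Ω n → MacroSpace d) (l₁ l₂ : MacroSpace d) : ℝ :=
  limUnder atTop fun n => (v n)⁻¹ * Real.log (dynamicPartition v P G₀ G₁ l₁ l₂ n)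

/-- The partial gradient `∇₁ Ψ (l₁, l₂)`. -/
def partialGradient₁ {d : ℕ} (Ψ : MacroSpace d → MacroSpace d → ℝ) (l₁ l₂ : MacroSpace d) :
    MacroSpace d :=
  gradient (fun l => Ψ l l₂) l₁

/-- The partial gradient `∇₂ Ψ (l₁, l₂)`. -/
def partialGradient₂ {d : ℕ} (Ψ : MacroSpace d → MacroSpace d → ℝ) (l₁ l₂ : MacroSpace d) :
    MacroSpace d :=
  gradient (fun l => Ψ l₁ l) l₂

/-- The convex conjugate of `Ψ`, as a function of the pair of macrostates `(a₁, a₂)`. -/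
def dynamicRate {d : ℕ} (Ψ : MacroSpace d → MacroSpace d → ℝ) (a : MacroSpace d × MacroSpace d) :
    EReal :=
  ⨆ (l₁ : MacroSpace d) (l₂ : MacroSpace d),
    ((inner ℝ l₁ a.1 + inner ℝ l₂ a.2 - Ψ l₁ l₂ : ℝ) : EReal)

/-- The conditioning set `B₀ = {a₁ : l₀ (a₁ - a₀) ≥ 0} × ℝ^d`. -/
def conditioningSet {d : ℕ} (l₀ a₀ : MacroSpace d) : Set (MacroSpace d × MacroSpace d) :=
  {p | 0 ≤ inner ℝ l₀ (p.1 - a₀)}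

open Classical in
/-- The macroscopic map `a₀ ↦ a_t = ∇₂ Ψ_t (l₀, 0)`, where `l₀` is a conjugate macrostate of `a₀`,
that is, `a₀ = ∇₁ Ψ_t (l₀, 0)`. (If no conjugate macrostate exists the value is `0`, by convention.) -/
def macroscopicMap {d : ℕ} (Ψ : MacroSpace d → MacroSpace d → ℝ) (a₀ : MacroSpace d) :
    MacroSpace d :=
  if h : ∃ l₀, partialGradient₁ Ψ l₀ 0 = a₀ then partialGradient₂ Ψ h.choose 0 else 0

/-- The Jacobian matrix `∂ (a₀)_i / ∂ (l₀)_j` of the map `l₀ ↦ a₀ = ∇₁ Ψ_t (l₀, 0)`. -/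
def macroJacobian {d : ℕ} (Ψ : MacroSpace d → MacroSpace d → ℝ) (l₀ : MacroSpace d) :
    Matrix (Fin d) (Fin d) ℝ :=
  Matrix.of fun i j =>
    (fderiv ℝ (fun l => partialGradient₁ Ψ l 0) l₀ (EuclideanSpace.single j 1)) i

/-! ### Extensive observables on noninteracting systems -/

/-- The product measure `P_n = P^n` on `X^n`. -/
def productMeasure {X : Type*} [MeasurableSpace X] (P : Measure X) (n : ℕ) :
    Measure (Fin n → X) :=
  Measure.pi fun _ => P

/-- The observable `G_n (x_1, …, x_n) = (1/n) ∑ g (x_i)`. -/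
def empiricalAverage {X : Type*} {d : ℕ} (g : X → MacroSpace d) (n : ℕ) (x : Fin n → X) :
    MacroSpace d :=
  (n : ℝ)⁻¹ • ∑ i, g (x i)

/-- The dynamics `Φ_{n,t} (x_1, …, x_n) = (φ_t (x_1), …, φ_t (x_n))`. -/
def productDynamics {X : Type*} (φ : ℝ → X → X) (n : ℕ) (t : ℝ) (x : Fin n → X) : Fin n → X :=
  fun i => φ t (x i)

/-- The observable at time `t`, `G_{n,t} = G_n ∘ Φ_{n,t}`. -/
def evolvedAverage {X : Type*} {d : ℕ} (g : X → MacroSpace d) (φ : ℝ → X → X) (t : ℝ) (n : ℕ) :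
    (Fin n → X) → MacroSpace d :=
  empiricalAverage g n ∘ productDynamics φ n t

/-- The dynamic free energy of the noninteracting system, with scale factors `v_n = n`. -/
def noninteractingFreeEnergy {X : Type*} [MeasurableSpace X] {d : ℕ} (P : Measure X)
    (g : X → MacroSpace d) (φ : ℝ → X → X) (t : ℝ) : MacroSpace d → MacroSpace d → ℝ :=
  dynamicFreeEnergy (fun n => (n : ℝ)) (productMeasure P) (empiricalAverage g)
    (evolvedAverage g φ t)

/-- The joint law of `(G_n, G_{n,t})` under `P_n`. -/
def jointLaw {X : Type*} [MeasurableSpace X] {d : ℕ} (P : Measure X)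
    (g : X → MacroSpace d) (φ : ℝ → X → X) (t : ℝ) (n : ℕ) :
    Measure (MacroSpace d × MacroSpace d) :=
  (productMeasure P n).map fun x => (empiricalAverage g n x, evolvedAverage g φ t n x)

/-- The canonical partition function `Z (l) = ∫ exp (l g) dP`. -/
def canonicalPartition {X : Type*} [MeasurableSpace X] {d : ℕ} (P : Measure X)
    (g : X → MacroSpace d) (l : MacroSpace d) : ℝ :=
  ∫ x, Real.exp (inner ℝ l (g x)) ∂P

/-- The canonical distribution `Z (l)⁻¹ exp (l g) dP`. -/
def canonicalMeasure {X : Type*} [MeasurableSpace X] {d : ℕ} (P : Measure X)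
    (g : X → MacroSpace d) (l : MacroSpace d) : Measure X :=
  P.tilted fun x => inner ℝ l (g x)

/-- The indicator function `1_C`, as an observable with values in `ℝ^1`. -/
def indicatorObservable {X : Type*} (C : Set X) (x : X) : MacroSpace 1 :=
  WithLp.toLp 2 fun _ => C.indicator (fun _ => (1 : ℝ)) x

end

/-!
The pair `h = (g, g ∘ φ_t)` is a bounded random vector with values in the Hilbert sum
`WithLp 2 (ℝ^d × ℝ^d)`, and `(G_n, G_{n,t})` is the mean of `n` independent copies of it. The dynamic
free energy is therefore the logarithmic moment generating function `Λ` of `h` (`logPartition`), and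
the large deviation statements are Cramér's theorem for bounded random vectors, in exponential form,
together with its conditioned version on a supporting half-space.

* `Λ` is differentiable, and its gradient at `l` is the mean of `h` under the measure tilted by
  `exp ⟪l, h⟫` (`hasGradientAt_logPartition`). By Jensen's inequality `Λ` lies above its tangents, so
  the supremum in the conjugate `I` at the gradient at `l` is attained at `l`; conversely, where it
  is attained at `l`, the point is the gradient at `l`.
* Upper bound (`cramer_upper_bound`): the sample means stay in a fixed ball, and the part of a closed
  set inside it is covered by finitely many half-spaces, each estimated by Chernoff's inequality.
* Lower bound (`cramer_lower_bound`): at a gradient, tilting turns the point into the mean, and the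
  weak law of large numbers, itself a consequence of the upper bound, applies. Any point `y` with
  `I y < ∞` is a limit of gradients of no larger rate, obtained by minimizing
  `Λ l - ⟪l, y⟫ + ε ‖l‖² / 2` (`exists_canonicalMean_mem`). No relative interiors are needed.
* Conditioning (`satisfiesLDP_cond_sampleMeanLaw`): the half-space `B₀` is exactly the one for which
  Chernoff's inequality at `l₀` gives `-inf I(B₀)`. Boundary points are pushed into its interior
  towards the gradient at `2 l₀` by convexity, unless `⟪l₀, h⟫` is almost surely constant, in which
  case the half-space has full measure (`cramer_lower_bound_inter`).
* Injectivity and independence of the conjugate macrostate both rest on strict monotonicity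
  (`ae_inner_eq_of_inner_canonicalMean_le`): equal gradients at `l` and `m` force `⟪m - l, h⟫` to be
  almost surely constant. Then the two tilted measures agree, and every Jacobian, being a covariance
  matrix, annihilates `m - l`.
-/

/-! ### Large deviation principles in exponential form -/

section ExponentialForm

variable {Y : Type*} [TopologicalSpace Y]

/-- The large deviation principle with speed `n` follows from exponential bounds: a lower bound
for open neighbourhoods of each point, and an upper bound for closed sets. -/
theorem SatisfiesLDP.of_exp_bounds [MeasurableSpace Y] {μ : ℕ → Measure Y}
    [∀ n, IsFiniteMeasure (μ n)] {I : Y → EReal} (nonneg : ∀ y, 0 ≤ I y) (lsc : LowerSemicontinuous I)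
    (lower : ∀ (U : Set Y) (y : Y) (r : ℝ), IsOpen U → y ∈ U → I y < r →
      ∀ᶠ n : ℕ in atTop, Real.exp (-(n * r)) ≤ (μ n).real U)
    (upper : ∀ (F : Set Y) (α β : ℝ), IsClosed F → α < β → (∀ y ∈ F, (β : EReal) < I y) →
      ∀ᶠ n : ℕ in atTop, (μ n).real F ≤ Real.exp (-(n * α))) :
    SatisfiesLDP (fun n => (n : ℝ)) μ I where
  nonneg := nonneg
  lsc := lsc
  lower A _ := by
    refine le_of_forall_lt fun c hc => ?_
    have h1 : (⨅ y ∈ interior A, I y) < -c := EReal.lt_neg_comm.mp hc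
    obtain ⟨y, hy⟩ := iInf_lt_iff.mp h1
    obtain ⟨hyA, hy⟩ := iInf_lt_iff.mp hy
    obtain ⟨r, hr1, hr2⟩ := EReal.lt_iff_exists_real_btwn.mp hy
    refine lt_of_lt_of_le (EReal.lt_neg_comm.mp hr2) (le_liminf_of_le (by isBoundedDefault) ?_)
    filter_upwards [lower _ y r isOpen_interior hyA hr1, eventually_gt_atTop 0] with n hn hn0
    have hn0' : (0 : ℝ) < n := Nat.cast_pos.mpr hn0
    have h2 : ENNReal.ofReal (Real.exp (-(n * r))) ≤ μ n A :=
      (ENNReal.ofReal_le_of_le_toReal hn).trans (measure_mono interior_subset)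
    have h3 := ENNReal.log_monotone h2
    rw [ENNReal.log_ofReal_of_pos (Real.exp_pos _), Real.log_exp] at h3
    have h4 := mul_le_mul_of_nonneg_left h3
      (EReal.coe_nonneg.mpr (inv_nonneg.mpr hn0'.le))
    rw [← EReal.coe_mul] at h4
    have h5 : (n : ℝ)⁻¹ * -(n * r) = -r := by field_simp
    rwa [h5, EReal.coe_neg] at h4
  upper A _ := by
    refine le_of_forall_gt fun c hc => ?_
    have h1 : -c < ⨅ y ∈ closure A, I y := EReal.neg_lt_comm.mp hc
    obtain ⟨β, hβ1, hβ2⟩ := EReal.lt_iff_exists_real_btwn.mp h1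
    obtain ⟨α, hα1, hα2⟩ := EReal.lt_iff_exists_real_btwn.mp hβ1
    refine lt_of_le_of_lt (limsup_le_of_le (by isBoundedDefault) ?_) (EReal.neg_lt_comm.mp hα1)
    filter_upwards [upper _ α β isClosed_closure (EReal.coe_lt_coe_iff.mp hα2)
      fun y hy => hβ2.trans_le (iInf₂_le y hy), eventually_gt_atTop 0] with n hn hn0
    have hn0' : (0 : ℝ) < n := Nat.cast_pos.mpr hn0
    have h2 : μ n A ≤ ENNReal.ofReal (Real.exp (-(n * α))) :=
      (measure_mono subset_closure).trans
        ((ENNReal.le_ofReal_iff_toReal_le (measure_ne_top _ _) (Real.exp_pos _).le).mpr hn)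
    have h3 := ENNReal.log_monotone h2
    rw [ENNReal.log_ofReal_of_pos (Real.exp_pos _), Real.log_exp] at h3
    have h4 := mul_le_mul_of_nonneg_left h3
      (EReal.coe_nonneg.mpr (inv_nonneg.mpr hn0'.le))
    rw [← EReal.coe_mul] at h4
    have h5 : (n : ℝ)⁻¹ * -(n * α) = -α := by field_simp
    rwa [h5, EReal.coe_neg] at h4

/-- A good lower semicontinuous rate function is bounded away from zero on a closed set that
contains none of its zeros. -/
theorem IsGoodRate.exists_pos_lt {I : Y → EReal} (hI : IsGoodRate I)
    (lsc : LowerSemicontinuous I) {F : Set Y} (hF : IsClosed F)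
    (hpos : ∀ y ∈ F, 0 < I y) : ∃ β : ℝ, 0 < β ∧ ∀ y ∈ F, (β : EReal) < I y := by
  have hK : IsCompact (F ∩ {y | I y ≤ ((1 : ℝ) : EReal)}) := (hI 1).inter_left hF
  rcases (F ∩ {y | I y ≤ ((1 : ℝ) : EReal)}).eq_empty_or_nonempty with h | h
  · refine ⟨1, one_pos, fun y hy => ?_⟩
    by_contra! hc
    exact (h ▸ (⟨hy, hc⟩ : y ∈ F ∩ {y | I y ≤ ((1 : ℝ) : EReal)}) : y ∈ (∅ : Set Y))
  · obtain ⟨z, hz, hmin⟩ := (lsc.lowerSemicontinuousOn _).exists_isMinOn h hK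
    obtain ⟨β, hβ1, hβ2⟩ := EReal.lt_iff_exists_real_btwn.mp (hpos z hz.1)
    refine ⟨β, EReal.coe_pos.mp hβ1, fun y hy => ?_⟩
    by_cases hy1 : I y ≤ ((1 : ℝ) : EReal)
    · exact hβ2.trans_le (hmin ⟨hy, hy1⟩)
    · exact (hβ2.trans_le hz.2).trans (not_le.mp hy1)

/-- Under an exponential upper bound with a good rate function, closed sets without zeros of the
rate function have vanishing measure. -/
theorem tendsto_measureReal_zero_of_upper_bound [MeasurableSpace Y] {μ : ℕ → Measure Y} {I : Y → EReal}
    (hI : IsGoodRate I) (lsc : LowerSemicontinuous I)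
    (upper : ∀ (F : Set Y) (α β : ℝ), IsClosed F → α < β → (∀ y ∈ F, (β : EReal) < I y) →
      ∀ᶠ n : ℕ in atTop, (μ n).real F ≤ Real.exp (-(n * α)))
    {F : Set Y} (hF : IsClosed F) (hpos : ∀ y ∈ F, 0 < I y) :
    Tendsto (fun n => (μ n).real F) atTop (𝓝 0) := by
  obtain ⟨β, hβ, h⟩ := hI.exists_pos_lt lsc hF hpos
  have hlim : Tendsto (fun n : ℕ => Real.exp (-(n * (β / 2)))) atTop (𝓝 0) :=
    Real.tendsto_exp_neg_atTop_nhds_zero.comp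
      (tendsto_natCast_atTop_atTop.atTop_mul_const (half_pos hβ))
  exact squeeze_zero' (Eventually.of_forall fun _ => measureReal_nonneg)
    (upper F (β / 2) β hF (half_lt_self hβ) h) hlim

/-- A large deviation principle is carried along a homeomorphism. -/
theorem SatisfiesLDP.map_homeomorph [MeasurableSpace Y] {Y' : Type*} [TopologicalSpace Y'] [MeasurableSpace Y']
    [BorelSpace Y] [BorelSpace Y'] {v : ℕ → ℝ} {μ : ℕ → Measure Y} {I : Y → EReal}
    (h : SatisfiesLDP v μ I) (e : Y ≃ₜ Y') :
    SatisfiesLDP v (fun n => (μ n).map e) (I ∘ e.symm) where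
  nonneg y := h.nonneg _
  lsc := h.lsc.comp e.symm.continuous
  lower A hA := by
    have := h.lower (e ⁻¹' A) (e.continuous.measurable hA)
    rw [← e.preimage_interior] at this
    simp only [Measure.map_apply e.continuous.measurable hA]
    refine le_trans (EReal.neg_le_neg_iff.mpr ?_) this
    refine le_iInf₂ fun y hy => (iInf₂_le (e.symm y) (by simpa using hy)).trans (by simp)
  upper A hA := by
    have := h.upper (e ⁻¹' A) (e.continuous.measurable hA)
    rw [← e.preimage_closure] at this
    simp only [Measure.map_apply e.continuous.measurable hA]
    refine le_trans this (EReal.neg_le_neg_iff.mpr ?_)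
    refine le_iInf₂ fun y hy => (iInf₂_le (e y) hy).trans (by simp)

theorem IsGoodRate.comp_homeomorph_symm {Y' : Type*} [TopologicalSpace Y'] {I : Y → EReal}
    (h : IsGoodRate I) (e : Y ≃ₜ Y') : IsGoodRate (I ∘ e.symm) := fun α => by
  have := (h α).image e.continuous
  rw [e.image_eq_preimage_symm] at this
  exact this

end ExponentialForm

/-! ### Exponential families of a bounded random vector -/

section ExponentialFamily

variable {X E : Type*} [MeasurableSpace X] [NormedAddCommGroup E] [InnerProductSpace ℝ E]

/-- The partition function `∫ exp ⟪l, h⟫ dP` of a random vector `h`. -/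
noncomputable def partitionFn (P : Measure X) (h : X → E) (l : E) : ℝ :=
  ∫ x, Real.exp (inner ℝ l (h x)) ∂P

/-- The logarithmic moment generating function of a random vector `h`. -/
noncomputable def logPartition (P : Measure X) (h : X → E) (l : E) : ℝ :=
  Real.log (partitionFn P h l)

/-- The mean of `h` under the canonical distribution with parameter `l`, which has density
proportional to `exp ⟪l, h⟫`. -/
noncomputable def canonicalMean (P : Measure X) (h : X → E) (l : E) : E :=
  (partitionFn P h l)⁻¹ • ∫ x, Real.exp (inner ℝ l (h x)) • h x ∂P

theorem inner_le_of_norm_le {X : Type*} {h : X → E} {K : ℝ} (hK : ∀ x, ‖h x‖ ≤ K) (l : E) (x : X) :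
    |inner ℝ l (h x)| ≤ ‖l‖ * K :=
  (abs_real_inner_le_norm _ _).trans (mul_le_mul_of_nonneg_left (hK x) (norm_nonneg _))

theorem partitionFn_tilted (P : Measure X) (h : X → E) (l m : E) :
    partitionFn (P.tilted fun x => inner ℝ m (h x)) h l =
      partitionFn P h (m + l) / partitionFn P h m := by
  unfold partitionFn
  rw [integral_exp_tilted]
  simp [inner_add_left]

theorem integral_tilted_inner {F : Type*} [NormedAddCommGroup F] [NormedSpace ℝ F]
    (P : Measure X) (h : X → E) (l : E) (k : X → F) :
    ∫ x, k x ∂(P.tilted fun x => inner ℝ l (h x)) =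
      (partitionFn P h l)⁻¹ • ∫ x, Real.exp (inner ℝ l (h x)) • k x ∂P := by
  rw [integral_tilted, ← integral_smul]
  simp only [smul_smul, partitionFn, div_eq_inv_mul]

theorem canonicalMean_eq_integral_tilted (P : Measure X) (h : X → E) (l : E) :
    canonicalMean P h l = ∫ x, h x ∂(P.tilted fun x => inner ℝ l (h x)) :=
  (integral_tilted_inner P h l h).symm

theorem canonicalMean_zero [IsProbabilityMeasure P] (h : X → E) :
    canonicalMean P h 0 = ∫ x, h x ∂P := by
  simp [canonicalMean, partitionFn]

variable [FiniteDimensional ℝ E] [MeasurableSpace E] [BorelSpace E] {P : Measure X} {h : X → E}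
  {K : ℝ}

theorem integrable_exp_inner_smul [IsFiniteMeasure P] {F : Type*} [NormedAddCommGroup F]
    [NormedSpace ℝ F] {k : X → F} (hh : Measurable h) (hK : ∀ x, ‖h x‖ ≤ K)
    (hk : AEStronglyMeasurable k P) {M : ℝ} (hM : ∀ x, ‖k x‖ ≤ M) (l : E) :
    Integrable (fun x => Real.exp (inner ℝ l (h x)) • k x) P := by
  refine Integrable.of_bound (C := Real.exp (‖l‖ * K) * M) ?_ (Eventually.of_forall fun x => ?_)
  · exact (Real.measurable_exp.comp (measurable_const.inner hh)).aestronglyMeasurable.smul hk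
  · rw [norm_smul, Real.norm_eq_abs, Real.abs_exp]
    exact mul_le_mul (Real.exp_le_exp.mpr ((le_abs_self _).trans (inner_le_of_norm_le hK l x)))
      (hM x) (norm_nonneg _) (Real.exp_pos _).le

theorem integrable_exp_inner [IsFiniteMeasure P] (hh : Measurable h) (hK : ∀ x, ‖h x‖ ≤ K) (l : E) :
    Integrable (fun x => Real.exp (inner ℝ l (h x))) P := by
  have := integrable_exp_inner_smul (P := P) (k := fun _ => (1 : ℝ)) hh hK
    aestronglyMeasurable_const (M := 1) (by simp) l
  simpa using this

theorem partitionFn_pos [IsProbabilityMeasure P] (hh : Measurable h) (hK : ∀ x, ‖h x‖ ≤ K) (l : E) :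
    0 < partitionFn P h l :=
  integral_exp_pos (integrable_exp_inner hh hK l)

theorem exp_logPartition [IsProbabilityMeasure P] (hh : Measurable h) (hK : ∀ x, ‖h x‖ ≤ K)
    (l : E) : Real.exp (logPartition P h l) = partitionFn P h l :=
  Real.exp_log (partitionFn_pos hh hK l)

/-- Integrals against the canonical weight may be differentiated in the parameter under the
integral sign. -/
theorem hasFDerivAt_integral_exp_inner_smul [IsFiniteMeasure P] {F : Type*} [NormedAddCommGroup F]
    [NormedSpace ℝ F] [FiniteDimensional ℝ F] {k : X → F} (hh : Measurable h)
    (hK : ∀ x, ‖h x‖ ≤ K) (hk : AEStronglyMeasurable k P) {M : ℝ} (hM : ∀ x, ‖k x‖ ≤ M) (l : E) :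
    HasFDerivAt (fun m : E => ∫ x, Real.exp (inner ℝ m (h x)) • k x ∂P)
      (∫ x, Real.exp (inner ℝ l (h x)) • (innerSL ℝ (h x)).smulRight (k x) ∂P) l := by
  have hmeas : AEStronglyMeasurable (fun x => (innerSL ℝ (h x)).smulRight (k x)) P := by
    have h1 : AEStronglyMeasurable (fun x => innerSL ℝ (h x)) P :=
      (innerSL ℝ).continuous.comp_aestronglyMeasurable hh.aestronglyMeasurable
    have h2 : Continuous fun p : (E →L[ℝ] ℝ) × F => p.1.smulRight p.2 :=
      (ContinuousLinearMap.smulRightL ℝ E F).continuous₂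
    exact h2.comp_aestronglyMeasurable (h1.prodMk hk)
  have hbd : ∀ x, ‖(innerSL ℝ (h x)).smulRight (k x)‖ ≤ K * M := fun x => by
    rw [ContinuousLinearMap.norm_smulRight_apply, innerSL_apply_norm]
    exact mul_le_mul (hK x) (hM x) (norm_nonneg _) ((norm_nonneg _).trans (hK x))
  refine hasFDerivAt_integral_of_dominated_of_fderiv_le (s := Metric.ball l 1)
    (bound := fun _ => Real.exp ((‖l‖ + 1) * |K|) * (K * M))
    (F' := fun m x => Real.exp (inner ℝ m (h x)) • (innerSL ℝ (h x)).smulRight (k x))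
    (Metric.ball_mem_nhds l one_pos) ?_ ?_ ?_ ?_ (integrable_const _) ?_
  · exact Eventually.of_forall fun m => (integrable_exp_inner_smul hh hK hk hM m).1
  · exact integrable_exp_inner_smul hh hK hk hM l
  · exact (integrable_exp_inner_smul hh hK hmeas hbd l).1
  · refine Eventually.of_forall fun x m hm => ?_
    rw [norm_smul, Real.norm_eq_abs, Real.abs_exp]
    refine mul_le_mul (Real.exp_le_exp.mpr ?_) (hbd x) (norm_nonneg _) (Real.exp_pos _).le
    refine ((le_abs_self _).trans (inner_le_of_norm_le hK m x)).trans ?_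
    have : ‖m‖ ≤ ‖l‖ + 1 := by
      have := norm_le_norm_add_norm_sub' m l
      rw [mem_ball_iff_norm] at hm
      linarith
    exact (mul_le_mul_of_nonneg_left (le_abs_self K) (norm_nonneg _)).trans
      (mul_le_mul_of_nonneg_right this (abs_nonneg _))
  · refine Eventually.of_forall fun x m _ => ?_
    have h1 : HasFDerivAt (fun m : E => inner ℝ m (h x)) (innerSL ℝ (h x)) m := by
      have := (innerSL ℝ (h x)).hasFDerivAt (x := m)
      refine this.congr_of_eventuallyEq (Eventually.of_forall fun y => ?_)
      simp [real_inner_comm]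
    have h2 := (h1.exp).smul_const (k x)
    convert h2 using 1
    ext v
    simp [smul_smul]

theorem hasFDerivAt_partitionFn [IsFiniteMeasure P] (hh : Measurable h) (hK : ∀ x, ‖h x‖ ≤ K)
    (l : E) : HasFDerivAt (partitionFn P h)
      (innerSL ℝ (∫ x, Real.exp (inner ℝ l (h x)) • h x ∂P)) l := by
  have h1 := hasFDerivAt_integral_exp_inner_smul (P := P) (k := fun _ => (1 : ℝ)) hh hK
    aestronglyMeasurable_const (M := 1) (by simp) l
  have hint := integrable_exp_inner_smul (P := P) hh hK hh.aestronglyMeasurable hK l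
  simp only [smul_eq_mul, mul_one] at h1
  refine h1.congr_fderiv ?_
  rw [← ContinuousLinearMap.integral_comp_comm _ hint]
  refine integral_congr_ae (Eventually.of_forall fun x => ?_)
  ext v
  change Real.exp (inner ℝ l (h x)) * (inner ℝ (h x) v * 1) =
    inner ℝ (Real.exp (inner ℝ l (h x)) • h x) v
  rw [real_inner_smul_left, mul_one]

theorem hasGradientAt_logPartition [IsProbabilityMeasure P] (hh : Measurable h)
    (hK : ∀ x, ‖h x‖ ≤ K) (l : E) :
    HasGradientAt (logPartition P h) (canonicalMean P h l) l := by
  rw [hasGradientAt_iff_hasFDerivAt]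
  have := (hasFDerivAt_partitionFn (P := P) hh hK l).log (partitionFn_pos hh hK l).ne'
  refine HasFDerivAt.congr_fderiv this ?_
  ext v
  simp [canonicalMean]

/-! #### Tilting -/

theorem isProbabilityMeasure_tilted_inner [IsProbabilityMeasure P] (hh : Measurable h)
    (hK : ∀ x, ‖h x‖ ≤ K) (m : E) :
    IsProbabilityMeasure (P.tilted fun x => inner ℝ m (h x)) :=
  isProbabilityMeasure_tilted (integrable_exp_inner hh hK m)

theorem logPartition_tilted [IsProbabilityMeasure P] (hh : Measurable h) (hK : ∀ x, ‖h x‖ ≤ K)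
    (l m : E) : logPartition (P.tilted fun x => inner ℝ m (h x)) h l =
      logPartition P h (m + l) - logPartition P h m := by
  unfold logPartition
  rw [partitionFn_tilted, Real.log_div (partitionFn_pos hh hK _).ne' (partitionFn_pos hh hK _).ne']

/-- Jensen's inequality for the exponential function. -/
theorem inner_integral_le_logPartition [IsProbabilityMeasure P] (hh : Measurable h)
    (hK : ∀ x, ‖h x‖ ≤ K) (l : E) : inner ℝ l (∫ x, h x ∂P) ≤ logPartition P h l := by
  have hint : Integrable h P :=
    Integrable.of_bound hh.aestronglyMeasurable K (Eventually.of_forall hK)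
  set c : ℝ := inner ℝ l (∫ x, h x ∂P) with hc
  have hc' : ∫ x, inner ℝ l (h x) ∂P = c := integral_inner hint l
  rw [logPartition, Real.le_log_iff_exp_le (partitionFn_pos hh hK l)]
  have h1 : ∀ x, Real.exp c * (inner ℝ l (h x) - c + 1) ≤ Real.exp (inner ℝ l (h x)) := fun x => by
    have := Real.add_one_le_exp (inner ℝ l (h x) - c)
    calc _ ≤ Real.exp c * Real.exp (inner ℝ l (h x) - c) :=
          mul_le_mul_of_nonneg_left this (Real.exp_pos _).le
      _ = _ := by rw [← Real.exp_add]; congr 1; ring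
  have hi : Integrable (fun x => inner ℝ l (h x)) P := hint.const_inner l
  have hi2 : Integrable (fun x => inner ℝ l (h x) - c) P := hi.sub (integrable_const c)
  have h2 := integral_mono ((hi2.add (integrable_const 1)).const_mul (Real.exp c))
    (integrable_exp_inner hh hK l) h1
  rw [integral_const_mul] at h2
  simp only [Pi.add_apply] at h2
  rw [integral_add hi2 (integrable_const 1), integral_sub hi (integrable_const c), hc'] at h2
  simpa [partitionFn] using h2

/-- The logarithmic moment generating function lies above its tangents. -/
theorem logPartition_add_inner_le [IsProbabilityMeasure P] (hh : Measurable h)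
    (hK : ∀ x, ‖h x‖ ≤ K) (l m : E) :
    logPartition P h l + inner ℝ (m - l) (canonicalMean P h l) ≤ logPartition P h m := by
  have := isProbabilityMeasure_tilted_inner (P := P) hh hK l
  have h1 := inner_integral_le_logPartition (P := P.tilted fun x => inner ℝ l (h x)) hh hK (m - l)
  rw [logPartition_tilted hh hK, ← canonicalMean_eq_integral_tilted, add_sub_cancel] at h1
  linarith

/-- Strict monotonicity of the gradient: it can fail to increase strictly along `v` only if
`⟪v, h⟫` is almost surely constant. -/
theorem ae_inner_eq_of_inner_canonicalMean_le [IsProbabilityMeasure P] (hh : Measurable h)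
    (hK : ∀ x, ‖h x‖ ≤ K) {l v : E}
    (hle : inner ℝ v (canonicalMean P h (l + v)) ≤ inner ℝ v (canonicalMean P h l)) :
    ∀ᵐ x ∂P, inner ℝ v (h x) = inner ℝ v (canonicalMean P h l) := by
  set c : ℝ := inner ℝ v (canonicalMean P h l) with hc
  have hkey : ∀ m : E, ∫ x, Real.exp (inner ℝ m (h x)) * (inner ℝ v (h x) - c) ∂P =
      partitionFn P h m * (inner ℝ v (canonicalMean P h m) - c) := fun m => by
    have hint := integrable_exp_inner_smul (P := P) hh hK hh.aestronglyMeasurable hK m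
    have hi1 : Integrable (fun x => Real.exp (inner ℝ m (h x)) * inner ℝ v (h x)) P := by
      simpa [inner_smul_right] using hint.const_inner (𝕜 := ℝ) v
    have h1 := integral_inner (𝕜 := ℝ) hint v
    simp only [inner_smul_right] at h1
    simp only [mul_sub]
    rw [integral_sub hi1 ((integrable_exp_inner hh hK m).mul_const c), h1, integral_mul_const]
    have hZ := (partitionFn_pos (P := P) hh hK m).ne'
    rw [canonicalMean, inner_smul_right, mul_inv_cancel_left₀ hZ]
    rfl
  have hi : ∀ m : E, Integrable (fun x => Real.exp (inner ℝ m (h x)) * (inner ℝ v (h x) - c)) P :=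
    fun m => by
      have := integrable_exp_inner_smul (P := P) (k := fun x => inner ℝ v (h x) - c) hh hK
        ((measurable_const.inner hh).sub_const c).aestronglyMeasurable
        (M := ‖v‖ * K + |c|) (fun x => (norm_sub_le _ _).trans
          (add_le_add (inner_le_of_norm_le hK v x) le_rfl)) m
      simpa using this
  -- with `u = ⟪v, h⟫`, the nonnegative function `exp ⟪l, h⟫ (u - c) (exp u - exp c)` has integral
  -- at most zero
  have hint : Integrable (fun x => Real.exp (inner ℝ (l + v) (h x)) * (inner ℝ v (h x) - c)
      - Real.exp c * (Real.exp (inner ℝ l (h x)) * (inner ℝ v (h x) - c))) P :=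
    (hi _).sub ((hi l).const_mul _)
  have heq : ∀ x, Real.exp (inner ℝ (l + v) (h x)) * (inner ℝ v (h x) - c)
      - Real.exp c * (Real.exp (inner ℝ l (h x)) * (inner ℝ v (h x) - c)) =
      Real.exp (inner ℝ l (h x)) *
        ((inner ℝ v (h x) - c) * (Real.exp (inner ℝ v (h x)) - Real.exp c)) := fun x => by
    rw [inner_add_left, Real.exp_add]; ring
  have hnonneg : ∀ a b : ℝ, 0 ≤ (a - b) * (Real.exp a - Real.exp b) := fun a b => by
    rcases le_total a b with hab | hab
    · exact mul_nonneg_of_nonpos_of_nonpos (sub_nonpos.mpr hab)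
        (sub_nonpos.mpr (Real.exp_le_exp.mpr hab))
    · exact mul_nonneg (sub_nonneg.mpr hab) (sub_nonneg.mpr (Real.exp_le_exp.mpr hab))
  have hle0 : ∫ x, (Real.exp (inner ℝ (l + v) (h x)) * (inner ℝ v (h x) - c)
      - Real.exp c * (Real.exp (inner ℝ l (h x)) * (inner ℝ v (h x) - c))) ∂P ≤ 0 := by
    rw [integral_sub (hi _) ((hi l).const_mul _), integral_const_mul, hkey, hkey, ← hc, sub_self,
      mul_zero, mul_zero, sub_zero]
    exact mul_nonpos_of_nonneg_of_nonpos (partitionFn_pos hh hK _).le (sub_nonpos.mpr hle)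
  have hge : 0 ≤ fun x => Real.exp (inner ℝ (l + v) (h x)) * (inner ℝ v (h x) - c)
      - Real.exp c * (Real.exp (inner ℝ l (h x)) * (inner ℝ v (h x) - c)) := fun x => by
    simp only [Pi.zero_apply, heq]
    exact mul_nonneg (Real.exp_pos _).le (hnonneg _ _)
  have h0 := (integral_eq_zero_iff_of_nonneg hge hint).mp (le_antisymm hle0 (integral_nonneg hge))
  filter_upwards [h0] with x hx
  simp only [Pi.zero_apply, heq, mul_eq_zero, (Real.exp_pos _).ne', false_or, sub_eq_zero,
    Real.exp_eq_exp, or_self] at hx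
  exact hx

end ExponentialFamily

/-! ### The convex conjugate of the logarithmic moment generating function -/

section CramerRate

variable {X E : Type*} [MeasurableSpace X] [NormedAddCommGroup E] [InnerProductSpace ℝ E]

/-- The convex conjugate of the logarithmic moment generating function of `h`. -/
noncomputable def cramerRate (P : Measure X) (h : X → E) (a : E) : EReal :=
  ⨆ l : E, ((inner ℝ l a - logPartition P h l : ℝ) : EReal)

theorem le_cramerRate (P : Measure X) (h : X → E) (l a : E) :
    ((inner ℝ l a - logPartition P h l : ℝ) : EReal) ≤ cramerRate P h a :=
  le_iSup (fun l : E => ((inner ℝ l a - logPartition P h l : ℝ) : EReal)) l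

theorem cramerRate_le_coe_iff {P : Measure X} {h : X → E} {a : E} {r : ℝ} :
    cramerRate P h a ≤ r ↔ ∀ l : E, inner ℝ l a - logPartition P h l ≤ r := by
  simp only [cramerRate, iSup_le_iff, EReal.coe_le_coe_iff]

theorem cramerRate_nonneg [IsProbabilityMeasure P] {h : X → E} (a : E) : 0 ≤ cramerRate P h a := by
  simpa [logPartition, partitionFn] using le_cramerRate P h 0 a

theorem lowerSemicontinuous_cramerRate (P : Measure X) (h : X → E) :
    LowerSemicontinuous (cramerRate P h) :=
  lowerSemicontinuous_iSup fun _ => (continuous_coe_real_ereal.comp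
    ((continuous_const.inner continuous_id).sub continuous_const)).lowerSemicontinuous

theorem eq_zero_of_innerSL_eq_zero {a : E} (ha : innerSL ℝ a = 0) : a = 0 :=
  inner_self_eq_zero (𝕜 := ℝ).mp (DFunLike.congr_fun ha a)

theorem isConvexRate_cramerRate (P : Measure X) (h : X → E) : IsConvexRate (cramerRate P h) := by
  rintro ⟨a, r⟩ ha ⟨b, s⟩ hb u v hu hv huv
  simp only [Set.mem_ofPred_eq, cramerRate_le_coe_iff] at ha hb
  simp only [Prod.smul_mk, Prod.mk_add_mk, Set.mem_ofPred_eq, cramerRate_le_coe_iff, smul_eq_mul,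
    inner_add_right, inner_smul_right]
  intro l
  have h1 := add_le_add (mul_le_mul_of_nonneg_left (ha l) hu) (mul_le_mul_of_nonneg_left (hb l) hv)
  have h2 : logPartition P h l = u * logPartition P h l + v * logPartition P h l := by
    rw [← add_mul, huv, one_mul]
  linarith

variable [FiniteDimensional ℝ E] [MeasurableSpace E] [BorelSpace E] {P : Measure X}
  [IsProbabilityMeasure P] {h : X → E} {K : ℝ}

theorem logPartition_le (hh : Measurable h) (hK : ∀ x, ‖h x‖ ≤ K) (l : E) :
    logPartition P h l ≤ ‖l‖ * K := by
  rw [logPartition, Real.log_le_iff_le_exp (partitionFn_pos hh hK l)]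
  have := integral_mono (integrable_exp_inner (P := P) hh hK l) (integrable_const _)
    fun x => Real.exp_le_exp.mpr ((le_abs_self _).trans (inner_le_of_norm_le hK l x))
  simpa [partitionFn] using this

theorem isGoodRate_cramerRate (hh : Measurable h) (hK : ∀ x, ‖h x‖ ≤ K) :
    IsGoodRate (cramerRate P h) := fun α => by
  refine Metric.isCompact_of_isClosed_isBounded
    ((lowerSemicontinuous_cramerRate P h).isClosed_preimage _) ?_
  refine (Metric.isBounded_closedBall (x := (0 : E)) (r := α + K)).subset fun a ha => ?_
  rw [mem_closedBall_zero_iff]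
  -- test the supremum against the unit vector in the direction of `a`
  have h1 := (cramerRate_le_coe_iff.mp ha) (‖a‖⁻¹ • a)
  rcases eq_or_ne a 0 with rfl | ha0
  · have h2 := cramerRate_le_coe_iff.mp ha 0
    obtain ⟨x⟩ : Nonempty X := nonempty_of_isProbabilityMeasure P
    have h3 := (norm_nonneg _).trans (hK x)
    simp [logPartition, partitionFn] at h2
    simpa using add_nonneg h2 h3
  · have hn : ‖a‖ ≠ 0 := norm_ne_zero_iff.mpr ha0
    have h2 := logPartition_le (P := P) hh hK (‖a‖⁻¹ • a)
    rw [norm_smul, norm_inv, norm_norm, inv_mul_cancel₀ hn, one_mul] at h2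
    rw [real_inner_smul_left, real_inner_self_eq_norm_sq, pow_two, inv_mul_cancel_left₀ hn] at h1
    linarith

/-- The supremum defining the conjugate at a gradient is attained at the dual point. -/
theorem cramerRate_canonicalMean (hh : Measurable h) (hK : ∀ x, ‖h x‖ ≤ K) (l : E) :
    cramerRate P h (canonicalMean P h l) =
      ((inner ℝ l (canonicalMean P h l) - logPartition P h l : ℝ) : EReal) := by
  refine le_antisymm (cramerRate_le_coe_iff.mpr fun m => ?_) (le_cramerRate P h l _)
  have := logPartition_add_inner_le (P := P) hh hK l m
  rw [inner_sub_left] at this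
  linarith

/-- If the supremum defining the conjugate at `a` is attained at `l`, then `a` is the gradient
at `l`. -/
theorem eq_canonicalMean_of_cramerRate_le (hh : Measurable h) (hK : ∀ x, ‖h x‖ ≤ K) {l a : E}
    (ha : cramerRate P h a ≤ ((inner ℝ l a - logPartition P h l : ℝ) : EReal)) :
    a = canonicalMean P h l := by
  have h1 := cramerRate_le_coe_iff.mp ha
  have h2 : HasFDerivAt (fun m : E => inner ℝ a m - logPartition P h m)
      (innerSL ℝ a - innerSL ℝ (canonicalMean P h l)) l :=
    (innerSL ℝ a).hasFDerivAt.sub (hasGradientAt_logPartition hh hK l).hasFDerivAt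
  have h3 : IsLocalMax (fun m : E => inner ℝ a m - logPartition P h m) l :=
    Eventually.of_forall fun m => by simpa only [real_inner_comm] using h1 m
  have h4 := h3.hasFDerivAt_eq_zero h2
  rw [← map_sub] at h4
  exact sub_eq_zero.mp (eq_zero_of_innerSL_eq_zero h4)

/-- Points of finite rate are limits of gradients of no larger rate: take the gradient at a
minimizer of `Λ l - ⟪l, y⟫ + ε ‖l‖² / 2` for small `ε`. -/
theorem exists_canonicalMean_mem (hh : Measurable h) (hK : ∀ x, ‖h x‖ ≤ K) {U : Set E} {y : E}
    {r : ℝ} (hU : IsOpen U) (hy : y ∈ U) (hr : cramerRate P h y < r) :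
    ∃ l : E, canonicalMean P h l ∈ U ∧
      inner ℝ l (canonicalMean P h l) - logPartition P h l < r := by
  obtain ⟨r', hr1, hr2⟩ := EReal.lt_iff_exists_real_btwn.mp hr
  rw [EReal.coe_lt_coe_iff] at hr2
  have hle := cramerRate_le_coe_iff.mp hr1.le
  obtain ⟨δ, hδ, hball⟩ := Metric.isOpen_iff.mp hU y hy
  have hr0 : 0 ≤ r' := by
    have := (cramerRate_nonneg (P := P) (h := h) y).trans hr1.le
    exact_mod_cast this
  -- with this `ε`, a minimizer `l` has `‖ε • l‖² ≤ 2 ε r' < δ²`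
  obtain ⟨ε, hε, hεδ⟩ : ∃ ε : ℝ, 0 < ε ∧ 2 * ε * r' < δ ^ 2 := by
    refine ⟨δ ^ 2 / (2 * (r' + 1)), by positivity, ?_⟩
    rw [show 2 * (δ ^ 2 / (2 * (r' + 1))) * r' = δ ^ 2 * (r' / (r' + 1)) by field_simp]
    have : r' / (r' + 1) < 1 := (div_lt_one (by linarith)).mpr (by linarith)
    nlinarith [pow_pos hδ 2]
  have hgrad := fun l => hasGradientAt_logPartition (P := P) hh hK l
  have hcontΛ : Continuous (logPartition P h) :=
    continuous_iff_continuousAt.mpr fun l => (hgrad l).hasFDerivAt.continuousAt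
  set f : E → ℝ := fun l => logPartition P h l - inner ℝ y l + ε / 2 * ‖l‖ ^ 2 with hf
  have hfc : Continuous f := by
    have : Continuous fun l : E => inner ℝ y l := continuous_const.inner continuous_id
    fun_prop
  have hflow : ∀ l, ε / 2 * ‖l‖ ^ 2 - r' ≤ f l := fun l => by
    have := hle l
    rw [real_inner_comm] at this
    simp only [hf]
    linarith
  have hf0 : f 0 = 0 := by simp [hf, logPartition, partitionFn]
  have hcoer : Tendsto f (cocompact E) atTop := by
    refine tendsto_atTop_mono hflow ?_
    refine tendsto_atTop_add_const_right _ _ ?_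
    exact ((tendsto_pow_atTop two_ne_zero).comp (tendsto_norm_cocompact_atTop)).const_mul_atTop
      (half_pos hε)
  obtain ⟨l, hl⟩ := hfc.exists_forall_le hcoer
  have hderiv : HasFDerivAt f (innerSL ℝ (canonicalMean P h l) - innerSL ℝ y
      + (ε / 2) • ((2 : ℝ) • innerSL ℝ l)) l := by
    have h1 := (((hgrad l).hasFDerivAt).sub ((innerSL ℝ y).hasFDerivAt (x := l))).add
      (((hasStrictFDerivAt_norm_sq l).hasFDerivAt).const_mul (ε / 2))
    refine HasFDerivAt.congr_fderiv h1 ?_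
    ext v
    simp
  have hzero := (show IsLocalMin f l from Eventually.of_forall hl).hasFDerivAt_eq_zero hderiv
  have hmean : canonicalMean P h l = y - ε • l := by
    have h1 : innerSL ℝ (canonicalMean P h l - y + ε • l) = 0 := by
      rw [← hzero, map_add, map_sub, map_smul, smul_smul, div_mul_cancel₀ _ two_ne_zero]
    have h2 := eq_zero_of_innerSL_eq_zero h1
    rw [eq_sub_iff_add_eq, ← sub_eq_zero, ← h2]
    abel
  have hfl : f l ≤ 0 := hf0 ▸ hl 0
  have hbound : ε / 2 * ‖l‖ ^ 2 ≤ r' := by linarith [hflow l]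
  refine ⟨l, hball ?_, ?_⟩
  · rw [hmean, mem_ball_iff_norm, sub_sub_cancel_left, norm_neg, norm_smul, Real.norm_eq_abs,
      abs_of_pos hε]
    refine lt_of_pow_lt_pow_left₀ 2 hδ.le (lt_of_le_of_lt ?_ hεδ)
    rw [mul_pow]
    nlinarith
  · refine lt_of_le_of_lt ?_ hr2
    have h1 := hle l
    rw [hmean, inner_sub_right, inner_smul_right, real_inner_self_eq_norm_sq]
    have : 0 ≤ ε * ‖l‖ ^ 2 := by positivity
    linarith

end CramerRate

/-! ### Sample means under product measures -/

section SampleMean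

variable {X E : Type*} [NormedAddCommGroup E] [InnerProductSpace ℝ E]

/-- The sample mean of `h` over `n` points; it is `0` for `n = 0`. -/
noncomputable def sampleMean (h : X → E) (n : ℕ) (x : Fin n → X) : E :=
  (n : ℝ)⁻¹ • ∑ i, h (x i)

theorem natCast_mul_inner_sampleMean (h : X → E) (n : ℕ) (x : Fin n → X) (l : E) :
    (n : ℝ) * inner ℝ l (sampleMean h n x) = ∑ i, inner ℝ l (h (x i)) := by
  rcases eq_or_ne n 0 with rfl | hn
  · simp
  · rw [sampleMean, inner_smul_right, mul_inv_cancel_left₀ (Nat.cast_ne_zero.mpr hn), inner_sum]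

theorem norm_sampleMean_le {h : X → E} {K : ℝ} (hK0 : 0 ≤ K) (hK : ∀ x, ‖h x‖ ≤ K) (n : ℕ)
    (x : Fin n → X) : ‖sampleMean h n x‖ ≤ K := by
  rcases eq_or_ne n 0 with rfl | hn
  · simpa [sampleMean] using hK0
  · have hn' : (0 : ℝ) < n := Nat.cast_pos.mpr (Nat.pos_of_ne_zero hn)
    rw [sampleMean, norm_smul, norm_inv, Real.norm_of_nonneg hn'.le, inv_mul_le_iff₀ hn']
    exact (norm_sum_le _ _).trans ((Finset.sum_le_sum fun i _ => hK (x i)).trans (by simp))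

variable [MeasurableSpace X]

instance (P : Measure X) [IsProbabilityMeasure P] (n : ℕ) :
    IsProbabilityMeasure (productMeasure P n) := by
  unfold productMeasure; infer_instance

/-- Tilting a product measure by a sum of functions of the coordinates tilts each factor. -/
theorem productMeasure_tilted (P : Measure X) [IsProbabilityMeasure P] {f : X → ℝ}
    (hf : Integrable (fun x => Real.exp (f x)) P) (n : ℕ) :
    productMeasure (P.tilted f) n = (productMeasure P n).tilted fun x => ∑ i, f (x i) := by
  have := isProbabilityMeasure_tilted hf
  refine Measure.pi_eq fun s hs => ?_
  rw [tilted_apply_eq_ofReal_integral' _ (MeasurableSet.univ_pi hs), productMeasure,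
    Measure.restrict_pi_pi]
  simp_rw [tilted_apply_eq_ofReal_integral' _ (hs _), Real.exp_sum]
  rw [integral_fintype_prod_eq_prod (fun _ x => Real.exp (f x)),
    ← ENNReal.ofReal_prod_of_nonneg
      fun i _ => integral_nonneg fun x => div_nonneg (Real.exp_pos _).le
        (integral_nonneg fun _ => (Real.exp_pos _).le)]
  congr 1
  rw [← integral_fintype_prod_eq_prod (fun _ x => Real.exp (f x) / ∫ x, Real.exp (f x) ∂P)]
  simp only [Finset.prod_div_distrib, Finset.prod_const, Finset.card_univ, Fintype.card_fin]

theorem integral_exp_natCast_mul_inner_sampleMean (P : Measure X) [IsProbabilityMeasure P]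
    (h : X → E) (l : E) (n : ℕ) :
    ∫ x, Real.exp (n * inner ℝ l (sampleMean h n x)) ∂(productMeasure P n) =
      partitionFn P h l ^ n := by
  simp_rw [natCast_mul_inner_sampleMean, Real.exp_sum]
  rw [productMeasure, integral_fintype_prod_eq_pow (fun x => Real.exp (inner ℝ l (h x))),
    Fintype.card_fin, partitionFn]

variable [FiniteDimensional ℝ E] [MeasurableSpace E] [BorelSpace E] {P : Measure X}
  [IsProbabilityMeasure P] {h : X → E} {K : ℝ}

theorem measurable_sampleMean (hh : Measurable h) (n : ℕ) : Measurable (sampleMean h n) :=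
  (Finset.measurable_sum _ fun i _ => hh.comp (measurable_pi_apply i)).const_smul _

theorem integrable_exp_natCast_mul_inner_sampleMean (hh : Measurable h) (hK : ∀ x, ‖h x‖ ≤ K)
    (l : E) (n : ℕ) :
    Integrable (fun x => Real.exp (n * inner ℝ l (sampleMean h n x))) (productMeasure P n) := by
  simp_rw [natCast_mul_inner_sampleMean, Real.exp_sum]
  exact Integrable.fintype_prod (f := fun _ x => Real.exp (inner ℝ l (h x)))
    fun _ => integrable_exp_inner hh hK l

/-- The law of the sample mean of `n` independent copies of `h`. -/
noncomputable def sampleMeanLaw (P : Measure X) (h : X → E) (n : ℕ) : Measure E :=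
  (productMeasure P n).map (sampleMean h n)

theorem isProbabilityMeasure_sampleMeanLaw (hh : Measurable h) (n : ℕ) :
    IsProbabilityMeasure (sampleMeanLaw P h n) :=
  Measure.isProbabilityMeasure_map (measurable_sampleMean hh n).aemeasurable

/-- Chernoff's bound for half-spaces. -/
theorem sampleMeanLaw_real_le (hh : Measurable h) (hK : ∀ x, ‖h x‖ ≤ K) {A : Set E} {α : ℝ}
    (l : E) (hA : ∀ a ∈ A, α ≤ inner ℝ l a - logPartition P h l) (n : ℕ) :
    (sampleMeanLaw P h n).real A ≤ Real.exp (-(n * α)) := by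
  have := isProbabilityMeasure_sampleMeanLaw (P := P) hh n
  set H : Set E := {a | α + logPartition P h l ≤ inner ℝ l a} with hH
  have hHm : MeasurableSet H :=
    (isClosed_le continuous_const (continuous_const.inner continuous_id)).measurableSet
  have hAH : A ⊆ H := fun a ha => by
    have := hA a ha
    simp only [hH, Set.mem_ofPred_eq]
    linarith
  refine (measureReal_mono hAH).trans ?_
  rw [sampleMeanLaw, map_measureReal_apply (measurable_sampleMean hh n) hHm]
  have h1 := mul_meas_ge_le_integral_of_nonneg
    (Eventually.of_forall fun x => (Real.exp_pos _).le)
    (integrable_exp_natCast_mul_inner_sampleMean (P := P) hh hK l n)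
    (Real.exp (n * (α + logPartition P h l)))
  rw [integral_exp_natCast_mul_inner_sampleMean, ← exp_logPartition hh hK, ← Real.exp_nat_mul,
    mul_add, Real.exp_add, mul_right_comm] at h1
  have h2 := le_of_mul_le_mul_right (h1.trans_eq (one_mul _).symm) (Real.exp_pos _)
  rw [Real.exp_neg, ← one_div, le_div_iff₀' (Real.exp_pos _)]
  refine le_trans (mul_le_mul_of_nonneg_left (measureReal_mono fun x hx => ?_)
    (Real.exp_pos _).le) h2
  simp only [hH, Set.mem_preimage, Set.mem_ofPred_eq] at hx ⊢
  rw [← Real.exp_add, ← mul_add]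
  exact Real.exp_le_exp.mpr (mul_le_mul_of_nonneg_left hx (Nat.cast_nonneg n))

/-- The upper bound of Cramér's theorem: the part of a closed set within the compact range of the
sample mean is covered by finitely many half-spaces, each subject to Chernoff's bound. -/
theorem cramer_upper_bound (hh : Measurable h) (hK : ∀ x, ‖h x‖ ≤ K) (F : Set E) (α β : ℝ)
    (hF : IsClosed F) (hαβ : α < β) (hI : ∀ y ∈ F, (β : EReal) < cramerRate P h y) :
    ∀ᶠ n : ℕ in atTop, (sampleMeanLaw P h n).real F ≤ Real.exp (-(n * α)) := by
  have hprob := isProbabilityMeasure_sampleMeanLaw (P := P) hh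
  obtain ⟨x₀⟩ : Nonempty X := nonempty_of_isProbabilityMeasure P
  have hK0 : 0 ≤ K := (norm_nonneg _).trans (hK x₀)
  have hcomp : IsCompact (F ∩ Metric.closedBall 0 K) := (isCompact_closedBall 0 K).inter_left hF
  have hex : ∀ y ∈ F, ∃ l : E, β < inner ℝ l y - logPartition P h l := fun y hy => by
    obtain ⟨l, hl⟩ := lt_iSup_iff.mp (hI y hy)
    exact ⟨l, EReal.coe_lt_coe_iff.mp hl⟩
  obtain ⟨t, ht⟩ := hcomp.elim_finite_subcover
    (fun l : E => {a : E | β < inner ℝ l a - logPartition P h l})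
    (fun l => isOpen_lt continuous_const
      ((continuous_const.inner continuous_id).sub continuous_const))
    fun y hy => Set.mem_iUnion.mpr (hex y hy.1)
  have hle : ∀ n : ℕ, (sampleMeanLaw P h n).real F ≤ t.card * Real.exp (-(n * β)) := fun n => by
    have h1 : (sampleMeanLaw P h n).real F ≤
        (sampleMeanLaw P h n).real (⋃ l ∈ t, {a : E | β < inner ℝ l a - logPartition P h l}) := by
      have hU : IsOpen (⋃ l ∈ t, {a : E | β < inner ℝ l a - logPartition P h l}) :=
        isOpen_biUnion fun l _ => isOpen_lt continuous_const
          ((continuous_const.inner continuous_id).sub continuous_const)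
      have hm := measurable_sampleMean hh n
      rw [sampleMeanLaw, map_measureReal_apply hm hF.measurableSet,
        map_measureReal_apply hm hU.measurableSet]
      exact measureReal_mono fun x hx => ht
        ⟨hx, mem_closedBall_zero_iff.mpr (norm_sampleMean_le hK0 hK n x)⟩
    refine h1.trans ((measureReal_biUnion_finset_le _ _).trans ?_)
    refine (Finset.sum_le_sum fun l _ => sampleMeanLaw_real_le hh hK l
      (fun a ha => (Set.mem_ofPred_eq ▸ ha : _ < _).le) n).trans ?_
    simp
  have hlim : Tendsto (fun n : ℕ => Real.exp (n * (β - α))) atTop atTop :=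
    Real.tendsto_exp_atTop.comp
      (tendsto_natCast_atTop_atTop.atTop_mul_const (sub_pos.mpr hαβ))
  filter_upwards [hlim.eventually_ge_atTop (t.card : ℝ)] with n hn
  refine (hle n).trans ((mul_le_mul_of_nonneg_right hn (Real.exp_pos _).le).trans_eq ?_)
  rw [← Real.exp_add]
  congr 1
  ring

end SampleMean

/-! ### Cramér's theorem for bounded random vectors -/

section Cramer

variable {X E : Type*} [MeasurableSpace X] [NormedAddCommGroup E] [InnerProductSpace ℝ E]
  [FiniteDimensional ℝ E] [MeasurableSpace E] [BorelSpace E] {P : Measure X}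
  [IsProbabilityMeasure P] {h : X → E} {K : ℝ}

/-- The weak law of large numbers, as a consequence of the exponential upper bound. -/
theorem tendsto_sampleMeanLaw_real_one (hh : Measurable h) (hK : ∀ x, ‖h x‖ ≤ K) {U : Set E}
    (hU : IsOpen U) (hmem : ∫ x, h x ∂P ∈ U) :
    Tendsto (fun n => (sampleMeanLaw P h n).real U) atTop (𝓝 1) := by
  have hprob := isProbabilityMeasure_sampleMeanLaw (P := P) hh
  have h0 : Tendsto (fun n => (sampleMeanLaw P h n).real Uᶜ) atTop (𝓝 0) := by
    refine tendsto_measureReal_zero_of_upper_bound (isGoodRate_cramerRate hh hK)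
      (lowerSemicontinuous_cramerRate P h) (cramer_upper_bound hh hK) hU.isClosed_compl
      fun y hy => ?_
    by_contra! hc
    have h1 : y = canonicalMean P h 0 := eq_canonicalMean_of_cramerRate_le hh hK
      (hc.trans (by simp [logPartition, partitionFn]))
    exact hy (h1 ▸ canonicalMean_zero (P := P) h ▸ hmem)
  have h1 := h0.const_sub 1
  simpa [probReal_compl_eq_one_sub hU.measurableSet] using h1

/-- Cramér's lower bound near a gradient: under the measure tilted by the dual point, the gradient
is the mean, and the weak law of large numbers applies. -/
theorem cramer_lower_bound_canonicalMean (hh : Measurable h) (hK : ∀ x, ‖h x‖ ≤ K) {U : Set E}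
    (hU : IsOpen U) {l : E} (hl : canonicalMean P h l ∈ U) {r : ℝ}
    (hr : inner ℝ l (canonicalMean P h l) - logPartition P h l < r) :
    ∀ᶠ n : ℕ in atTop, Real.exp (-(n * r)) ≤ (sampleMeanLaw P h n).real U := by
  set y := canonicalMean P h l with hy
  set δ : ℝ := (r - (inner ℝ l y - logPartition P h l)) / 2 with hδ
  have hδ0 : 0 < δ := half_pos (sub_pos.mpr hr)
  have hQ := isProbabilityMeasure_tilted_inner (P := P) hh hK l
  set V : Set E := U ∩ {a | inner ℝ l a < inner ℝ l y + δ} with hV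
  have hVo : IsOpen V :=
    hU.inter (isOpen_lt (continuous_const.inner continuous_id) continuous_const)
  have hyV : ∫ x, h x ∂(P.tilted fun x => inner ℝ l (h x)) ∈ V := by
    rw [← canonicalMean_eq_integral_tilted]
    exact ⟨hl, by simp only [Set.mem_ofPred_eq, ← hy]; linarith⟩
  have hlaw := tendsto_sampleMeanLaw_real_one hh hK hVo hyV
  have hlim : Tendsto (fun n : ℕ => Real.exp (n * δ)) atTop atTop :=
    Real.tendsto_exp_atTop.comp (tendsto_natCast_atTop_atTop.atTop_mul_const hδ0)
  filter_upwards [hlaw.eventually_const_le (show (1 / 2 : ℝ) < 1 by norm_num),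
    hlim.eventually_ge_atTop 2] with n hn hn2
  have hprob := isProbabilityMeasure_sampleMeanLaw (P := P) hh n
  have hm := measurable_sampleMean hh n
  refine le_trans ?_ (measureReal_mono (show V ⊆ U from Set.inter_subset_left))
  rw [sampleMeanLaw, map_measureReal_apply hm hVo.measurableSet] at hn ⊢
  have hS := hm hVo.measurableSet
  rw [productMeasure_tilted P (integrable_exp_inner hh hK l)] at hn
  simp_rw [← natCast_mul_inner_sampleMean] at hn
  -- on the preimage of `V` the density of the tilted measure is at most `C`
  set C : ℝ := Real.exp (n * (r - δ)) with hC
  have hCle : ∀ x ∈ sampleMean h n ⁻¹' V, Real.exp (n * inner ℝ l (sampleMean h n x)) /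
      ∫ x, Real.exp (n * inner ℝ l (sampleMean h n x)) ∂(productMeasure P n) ≤ C := by
    intro x hx
    rw [integral_exp_natCast_mul_inner_sampleMean, ← exp_logPartition hh hK, ← Real.exp_nat_mul,
      ← Real.exp_sub, ← mul_sub, hC]
    refine Real.exp_le_exp.mpr (mul_le_mul_of_nonneg_left ?_ (Nat.cast_nonneg n))
    have h1 : inner ℝ l (sampleMean h n x) < inner ℝ l y + δ := hx.2
    linarith
  have hbd : ((productMeasure P n).tilted fun x => n * inner ℝ l (sampleMean h n x)).real
      (sampleMean h n ⁻¹' V) ≤ C * (productMeasure P n).real (sampleMean h n ⁻¹' V) := by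
    rw [measureReal_def, tilted_apply' _ _ hS]
    refine ENNReal.toReal_le_of_le_ofReal (by positivity) ?_
    refine (setLIntegral_mono' hS fun x hx => ENNReal.ofReal_le_ofReal (hCle x hx)).trans_eq ?_
    rw [setLIntegral_const, ENNReal.ofReal_mul (Real.exp_pos _).le, ofReal_measureReal]
  have h1 := hn.trans hbd
  have h2 : Real.exp (-(n * r)) * (C * Real.exp (n * δ)) = 1 := by
    rw [hC, ← Real.exp_add, ← Real.exp_add, Real.exp_eq_one_iff]; ring
  have h3 : Real.exp (-(n * r)) * C ≤ 1 / 2 := by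
    have : 0 ≤ Real.exp (-(n * r)) * C := by positivity
    nlinarith
  have hCpos : 0 < C := Real.exp_pos _
  exact le_of_mul_le_mul_left (by linarith) hCpos

/-- The lower bound of Cramér's theorem. -/
theorem cramer_lower_bound (hh : Measurable h) (hK : ∀ x, ‖h x‖ ≤ K) (U : Set E) (y : E) (r : ℝ)
    (hU : IsOpen U) (hy : y ∈ U) (hr : cramerRate P h y < r) :
    ∀ᶠ n : ℕ in atTop, Real.exp (-(n * r)) ≤ (sampleMeanLaw P h n).real U := by
  obtain ⟨l, hl, hlr⟩ := exists_canonicalMean_mem hh hK hU hy hr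
  exact cramer_lower_bound_canonicalMean hh hK hU hl hlr

/-- **Cramér's theorem** for bounded random vectors. -/
theorem satisfiesLDP_sampleMeanLaw (hh : Measurable h) (hK : ∀ x, ‖h x‖ ≤ K) :
    SatisfiesLDP (fun n => (n : ℝ)) (sampleMeanLaw P h) (cramerRate P h) := by
  have := isProbabilityMeasure_sampleMeanLaw (P := P) hh
  exact SatisfiesLDP.of_exp_bounds cramerRate_nonneg (lowerSemicontinuous_cramerRate P h)
    (cramer_lower_bound hh hK) (cramer_upper_bound hh hK)

/-- Canonical averages of the sample mean of an observable `k`, for every positive sample size,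
equal the canonical average over a single copy. -/
theorem canonical_average_sampleMean {F : Type*} [NormedAddCommGroup F] [InnerProductSpace ℝ F]
    (hh : Measurable h) (hK : ∀ x, ‖h x‖ ≤ K) {k : X → F} {M : ℝ}
    (hk : StronglyMeasurable k) (hM : ∀ x, ‖k x‖ ≤ M) (l : E) {n : ℕ} (hn : n ≠ 0) :
    (∫ x, Real.exp (n * inner ℝ l (sampleMean h n x)) ∂(productMeasure P n))⁻¹ •
      ∫ x, Real.exp (n * inner ℝ l (sampleMean h n x)) • sampleMean k n x ∂(productMeasure P n) =
    (partitionFn P h l)⁻¹ • ∫ x, Real.exp (inner ℝ l (h x)) • k x ∂P := by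
  have hQ := isProbabilityMeasure_tilted_inner (P := P) hh hK l
  have h1 : (∫ x, Real.exp (n * inner ℝ l (sampleMean h n x)) ∂(productMeasure P n))⁻¹ •
      ∫ x, Real.exp (n * inner ℝ l (sampleMean h n x)) • sampleMean k n x ∂(productMeasure P n) =
      ∫ x, sampleMean k n x ∂(productMeasure (P.tilted fun x => inner ℝ l (h x)) n) := by
    rw [productMeasure_tilted P (integrable_exp_inner hh hK l), integral_tilted, ← integral_smul]
    simp only [smul_smul, div_eq_inv_mul, natCast_mul_inner_sampleMean]
  rw [h1, ← integral_tilted_inner]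
  simp only [sampleMean]
  have hmp := fun i : Fin n =>
    measurePreserving_eval (fun _ : Fin n => P.tilted fun x => inner ℝ l (h x)) i
  have hint : Integrable k (P.tilted fun x => inner ℝ l (h x)) :=
    Integrable.of_bound hk.aestronglyMeasurable M (Eventually.of_forall hM)
  have hi : ∀ i : Fin n, Integrable (fun x : Fin n → X => k (x i))
      (productMeasure (P.tilted fun x => inner ℝ l (h x)) n) :=
    fun i => (hmp i).integrable_comp_of_integrable hint
  rw [integral_smul, integral_finsetSum _ fun i _ => hi i]
  have h2 : ∀ i : Fin n, ∫ x, k (x i) ∂(productMeasure (P.tilted fun x => inner ℝ l (h x)) n) =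
      ∫ x, k x ∂(P.tilted fun x => inner ℝ l (h x)) := fun i => by
    conv_rhs => rw [← (hmp i).map_eq]
    exact (integral_map (measurable_pi_apply i).aemeasurable hk.aestronglyMeasurable).symm
  rw [Finset.sum_congr rfl fun i _ => h2 i, Finset.sum_const, Finset.card_univ, Fintype.card_fin,
    ← Nat.cast_smul_eq_nsmul ℝ, smul_smul, inv_mul_cancel₀ (Nat.cast_ne_zero.mpr hn), one_smul]

end Cramer

/-! ### Conditioning on a closed set of finite rate -/

section ConditionalRate

variable {Y : Type*} [TopologicalSpace Y] {I : Y → EReal} {B : Set Y} {c : ℝ}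

theorem conditionalRate_le_coe_iff (hB : IsClosed B) (hc : ⨅ z ∈ B, I z = (c : EReal)) {y : Y}
    {r : ℝ} : conditionalRate I B y ≤ r ↔ y ∈ B ∧ I y ≤ ((r + c : ℝ) : EReal) := by
  rw [conditionalRate, hB.closure_eq, hc]
  split_ifs with hy
  · rw [EReal.sub_le_iff_le_add (.inl (EReal.coe_ne_bot c)) (.inl (EReal.coe_ne_top c)),
      EReal.coe_add]
    exact (and_iff_right hy).symm
  · exact iff_of_false (not_le.mpr (EReal.coe_lt_top r)) fun h => hy h.1

theorem conditionalRate_lt_coe_iff (hB : IsClosed B) (hc : ⨅ z ∈ B, I z = (c : EReal)) {y : Y}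
    {r : ℝ} : conditionalRate I B y < r ↔ y ∈ B ∧ I y < ((r + c : ℝ) : EReal) := by
  rw [conditionalRate, hB.closure_eq, hc]
  split_ifs with hy
  · rw [EReal.sub_lt_iff (.inl (EReal.coe_ne_bot c)) (.inl (EReal.coe_ne_top c)), EReal.coe_add]
    exact (and_iff_right hy).symm
  · exact iff_of_false not_top_lt fun h => hy h.1

theorem conditionalRate_nonneg (hB : IsClosed B) (hc : ⨅ z ∈ B, I z = (c : EReal)) (y : Y) :
    0 ≤ conditionalRate I B y := by
  rw [conditionalRate, hB.closure_eq]
  split_ifs with hy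
  · rw [hc, EReal.sub_nonneg (.inr (EReal.coe_ne_top c)) (.inr (EReal.coe_ne_bot c)), ← hc]
    exact iInf₂_le y hy
  · exact le_top

theorem lowerSemicontinuous_conditionalRate (hB : IsClosed B) (hc : ⨅ z ∈ B, I z = (c : EReal))
    (hI : LowerSemicontinuous I) : LowerSemicontinuous (conditionalRate I B) := by
  rw [lowerSemicontinuous_iff_isClosed_preimage]
  intro y
  induction y with
  | bot =>
    convert isClosed_empty
    refine Set.eq_empty_of_forall_notMem fun z hz => ?_
    exact absurd (conditionalRate_nonneg hB hc z) (not_le.mpr (lt_of_le_of_lt hz EReal.bot_lt_zero))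
  | top => simp
  | coe r =>
    convert hB.inter (hI.isClosed_preimage ((r + c : ℝ) : EReal)) using 1
    ext z
    exact conditionalRate_le_coe_iff hB hc

theorem isGoodRate_conditionalRate (hB : IsClosed B) (hc : ⨅ z ∈ B, I z = (c : EReal))
    (hI : IsGoodRate I) : IsGoodRate (conditionalRate I B) := fun r => by
  convert (hI (r + c)).inter_left hB using 1
  ext z
  exact conditionalRate_le_coe_iff hB hc

end ConditionalRate

theorem isConvexRate_conditionalRate {Y : Type*} [AddCommGroup Y] [Module ℝ Y] [TopologicalSpace Y]
    {I : Y → EReal} {B : Set Y} {c : ℝ} (hB : IsClosed B) (hBc : Convex ℝ B)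
    (hc : ⨅ z ∈ B, I z = (c : EReal)) (hI : IsConvexRate I) :
    IsConvexRate (conditionalRate I B) := by
  rintro ⟨a, r⟩ ha ⟨b, s⟩ hb u v hu hv huv
  rw [Set.mem_ofPred_eq, conditionalRate_le_coe_iff hB hc] at ha hb ⊢
  refine ⟨hBc ha.1 hb.1 hu hv huv, ?_⟩
  have h1 : ((u • (a, r + c) + v • (b, s + c) : Y × ℝ)) ∈ {p : Y × ℝ | I p.1 ≤ (p.2 : EReal)} :=
    hI ha.2 hb.2 hu hv huv
  have h2 : u * (r + c) + v * (s + c) = u * r + v * s + c := by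
    have : c = u * c + v * c := by rw [← add_mul, huv, one_mul]
    linarith
  simpa [h2] using h1

/-! ### Conditioning sample means on a supporting half-space -/

section ConditionalCramer

variable {X E : Type*} [MeasurableSpace X] [NormedAddCommGroup E] [InnerProductSpace ℝ E]

/-- The closed half-space through the canonical mean at `l`, with inner normal `l`. -/
def supportingHalfSpace (P : Measure X) (h : X → E) (l : E) : Set E :=
  {a | 0 ≤ inner ℝ l (a - canonicalMean P h l)}

theorem isClosed_supportingHalfSpace (P : Measure X) (h : X → E) (l : E) :
    IsClosed (supportingHalfSpace P h l) :=
  isClosed_le continuous_const (continuous_const.inner (continuous_id.sub continuous_const))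

theorem convex_supportingHalfSpace (P : Measure X) (h : X → E) (l : E) :
    Convex ℝ (supportingHalfSpace P h l) := by
  have h1 : supportingHalfSpace P h l =
      {a | inner ℝ l (canonicalMean P h l) ≤ innerSL ℝ l a} := by
    ext a
    simp [supportingHalfSpace, inner_sub_right]
  rw [h1]
  exact convex_halfSpace_ge (innerSL ℝ l).isLinear _

theorem canonicalMean_mem_supportingHalfSpace (P : Measure X) (h : X → E) (l : E) :
    canonicalMean P h l ∈ supportingHalfSpace P h l := by
  simp [supportingHalfSpace]

variable [FiniteDimensional ℝ E] [MeasurableSpace E] [BorelSpace E] {P : Measure X}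
  [IsProbabilityMeasure P] {h : X → E} {K : ℝ}

theorem iInf_cramerRate_supportingHalfSpace (hh : Measurable h) (hK : ∀ x, ‖h x‖ ≤ K) (l : E) :
    ⨅ a ∈ supportingHalfSpace P h l, cramerRate P h a =
      ((inner ℝ l (canonicalMean P h l) - logPartition P h l : ℝ) : EReal) := by
  refine le_antisymm ((iInf₂_le _ (canonicalMean_mem_supportingHalfSpace P h l)).trans_eq
    (cramerRate_canonicalMean hh hK l)) (le_iInf₂ fun a ha => ?_)
  refine le_trans (EReal.coe_le_coe_iff.mpr ?_) (le_cramerRate P h l a)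
  rw [supportingHalfSpace, Set.mem_ofPred_eq, inner_sub_right] at ha
  linarith

theorem sampleMeanLaw_supportingHalfSpace_le (hh : Measurable h) (hK : ∀ x, ‖h x‖ ≤ K) (l : E)
    (n : ℕ) : (sampleMeanLaw P h n).real (supportingHalfSpace P h l) ≤
      Real.exp (-(n * (inner ℝ l (canonicalMean P h l) - logPartition P h l))) := by
  refine sampleMeanLaw_real_le hh hK l (fun a ha => ?_) n
  rw [supportingHalfSpace, Set.mem_ofPred_eq, inner_sub_right] at ha
  linarith

/-- The half-space has positive probability: each copy of `h` lies in it with positive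
probability, because the canonical mean does. -/
theorem sampleMeanLaw_supportingHalfSpace_pos (hh : Measurable h) (hK : ∀ x, ‖h x‖ ≤ K) (l : E)
    {n : ℕ} (hn : n ≠ 0) : 0 < sampleMeanLaw P h n (supportingHalfSpace P h l) := by
  have hQ := isProbabilityMeasure_tilted_inner (P := P) hh hK l
  set Q := P.tilted fun x => inner ℝ l (h x) with hQdef
  have hint : Integrable h Q :=
    Integrable.of_bound hh.aestronglyMeasurable K (Eventually.of_forall hK)
  have h1 := measure_integral_le_pos (μ := Q) (hint.const_inner (𝕜 := ℝ) l)
  rw [integral_inner hint l, hQdef, ← canonicalMean_eq_integral_tilted] at h1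
  set A : Set X := {x | inner ℝ l (canonicalMean P h l) ≤ inner ℝ l (h x)} with hA
  have hPA : 0 < P A :=
    pos_iff_ne_zero.mpr fun h0 => h1.ne' (tilted_absolutelyContinuous P _ h0)
  rw [sampleMeanLaw, Measure.map_apply (measurable_sampleMean hh n)
    (isClosed_supportingHalfSpace P h l).measurableSet]
  have h2 : 0 < productMeasure P n (Set.univ.pi fun _ => A) := by
    rw [productMeasure, Measure.pi_pi]
    exact pos_iff_ne_zero.mpr (Finset.prod_ne_zero_iff.mpr fun _ _ => hPA.ne')
  refine h2.trans_le (measure_mono fun x hx => ?_)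
  have hn' : (0 : ℝ) < n := Nat.cast_pos.mpr (Nat.pos_of_ne_zero hn)
  rw [Set.mem_preimage, supportingHalfSpace, Set.mem_ofPred_eq, inner_sub_right, sub_nonneg]
  refine le_of_mul_le_mul_left ?_ hn'
  rw [natCast_mul_inner_sampleMean]
  have h3 := Finset.card_nsmul_le_sum Finset.univ (fun i => inner ℝ l (h (x i))) _
    fun i _ => hx i (Set.mem_univ i)
  simpa using h3

/-- If `⟪l, h⟫` is almost surely constant, then the sample mean lies in the half-space almost
surely. -/
theorem ae_mem_supportingHalfSpace (hh : Measurable h) {l : E}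
    (hae : ∀ᵐ x ∂P, inner ℝ l (h x) = inner ℝ l (canonicalMean P h l)) {n : ℕ} (hn : n ≠ 0) :
    ∀ᵐ a ∂(sampleMeanLaw P h n), a ∈ supportingHalfSpace P h l := by
  rw [sampleMeanLaw]
  refine (ae_map_iff (p := fun a => a ∈ supportingHalfSpace P h l)
    (measurable_sampleMean hh n).aemeasurable
    (isClosed_supportingHalfSpace P h l).measurableSet).mpr ?_
  have h1 : ∀ i : Fin n, ∀ᵐ x ∂(productMeasure P n),
      inner ℝ l (h (x i)) = inner ℝ l (canonicalMean P h l) := fun i =>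
    (measurePreserving_eval (fun _ : Fin n => P) i).quasiMeasurePreserving.ae hae
  filter_upwards [ae_all_iff.mpr h1] with x hx
  have hn' : (n : ℝ) ≠ 0 := Nat.cast_ne_zero.mpr hn
  have h2 : inner ℝ l (sampleMean h n x) = inner ℝ l (canonicalMean P h l) := by
    refine mul_left_cancel₀ hn' ?_
    rw [natCast_mul_inner_sampleMean, Finset.sum_congr rfl fun i _ => hx i]
    simp
  simp [supportingHalfSpace, inner_sub_right, h2]

/-- The lower bound of Cramér's theorem persists inside the half-space. If `⟪l, h⟫` is not almost
surely constant, points of the boundary are moved into the interior, towards the canonical mean at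
`2 l`, at small cost by convexity; otherwise the half-space has full measure. -/
theorem cramer_lower_bound_inter (hh : Measurable h) (hK : ∀ x, ‖h x‖ ≤ K) (l : E) {U : Set E}
    {y : E} {r : ℝ} (hU : IsOpen U) (hyU : y ∈ U) (hyH : y ∈ supportingHalfSpace P h l)
    (hr : cramerRate P h y < r) : ∀ᶠ n : ℕ in atTop,
      Real.exp (-(n * r)) ≤ (sampleMeanLaw P h n).real (supportingHalfSpace P h l ∩ U) := by
  have hprob := isProbabilityMeasure_sampleMeanLaw (P := P) hh
  by_cases hdeg : inner ℝ l (canonicalMean P h (l + l)) ≤ inner ℝ l (canonicalMean P h l)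
  · have hae := ae_inner_eq_of_inner_canonicalMean_le hh hK hdeg
    filter_upwards [cramer_lower_bound hh hK U y r hU hyU hr, eventually_ne_atTop 0] with n hn hn0
    refine hn.trans_eq (measureReal_congr ?_)
    filter_upwards [ae_mem_supportingHalfSpace hh hae hn0] with a ha
    exact propext ⟨fun hu => ⟨ha, hu⟩, fun hu => hu.2⟩
  · push Not at hdeg
    set z := canonicalMean P h (l + l) with hz
    obtain ⟨r', hr1, hr2⟩ := EReal.lt_iff_exists_real_btwn.mp hr
    rw [EReal.coe_lt_coe_iff] at hr2
    set ρ : ℝ := inner ℝ (l + l) z - logPartition P h (l + l) with hρ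
    have hIz : cramerRate P h z ≤ ρ := (cramerRate_canonicalMean hh hK (l + l)).le
    have hlim1 : Tendsto (fun s : ℝ => (1 - s) • y + s • z) (𝓝[>] 0) (𝓝 y) := by
      have : Continuous fun s : ℝ => (1 - s) • y + s • z := by fun_prop
      simpa using (this.tendsto 0).mono_left nhdsWithin_le_nhds
    have hlim2 : Tendsto (fun s : ℝ => (1 - s) * r' + s * ρ) (𝓝[>] 0) (𝓝 r') := by
      have : Continuous fun s : ℝ => (1 - s) * r' + s * ρ := by fun_prop
      simpa using (this.tendsto 0).mono_left nhdsWithin_le_nhds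
    obtain ⟨s, hsU, hsr, hs0, hs1⟩ := ((hlim1.eventually_mem (hU.mem_nhds hyU)).and
      ((hlim2.eventually_lt_const hr2).and (Ioo_mem_nhdsGT (one_pos : (0 : ℝ) < 1)))).exists
    have hIw : cramerRate P h ((1 - s) • y + s • z) ≤ (((1 - s) * r' + s * ρ : ℝ) : EReal) := by
      have := isConvexRate_cramerRate P h (x := (y, r')) hr1.le (y := (z, ρ)) hIz
        (sub_nonneg.mpr hs1.le) hs0.le (sub_add_cancel 1 s)
      simpa using this
    set W : Set E := U ∩ {a | 0 < inner ℝ l (a - canonicalMean P h l)} with hW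
    have hWo : IsOpen W := hU.inter
      (isOpen_lt continuous_const (continuous_const.inner (continuous_id.sub continuous_const)))
    have hwW : (1 - s) • y + s • z ∈ W := by
      refine ⟨hsU, ?_⟩
      rw [supportingHalfSpace, Set.mem_ofPred_eq, inner_sub_right, sub_nonneg] at hyH
      rw [Set.mem_ofPred_eq, inner_sub_right, inner_add_right, inner_smul_right, inner_smul_right]
      nlinarith
    filter_upwards [cramer_lower_bound hh hK W _ r hWo hwW
      (hIw.trans_lt (EReal.coe_lt_coe_iff.mpr hsr))] with n hn
    refine hn.trans (measureReal_mono fun a ha => ⟨?_, ha.1⟩)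
    exact (show 0 < inner ℝ l (a - canonicalMean P h l) from ha.2).le

theorem cond_real_eq {Y : Type*} [MeasurableSpace Y] {μ : Measure Y} {B : Set Y}
    (hB : MeasurableSet B) (A : Set Y) : (cond μ B).real A = (μ.real B)⁻¹ * μ.real (B ∩ A) := by
  simp [measureReal_def, cond_apply hB, ENNReal.toReal_mul, ENNReal.toReal_inv]

/-- Chernoff's bound for the half-space is exact on the exponential scale, so that dividing by its
probability costs nothing here. -/
theorem conditional_lower_bound (hh : Measurable h) (hK : ∀ x, ‖h x‖ ≤ K) (l : E) (U : Set E)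
    (y : E) (r : ℝ) (hU : IsOpen U) (hyU : y ∈ U)
    (hr : conditionalRate (cramerRate P h) (supportingHalfSpace P h l) y < r) :
    ∀ᶠ n : ℕ in atTop, Real.exp (-(n * r)) ≤
      (cond (sampleMeanLaw P h n) (supportingHalfSpace P h l)).real U := by
  have hB := isClosed_supportingHalfSpace P h l
  obtain ⟨hyH, hy⟩ :=
    (conditionalRate_lt_coe_iff hB (iInf_cramerRate_supportingHalfSpace hh hK l)).mp hr
  filter_upwards [cramer_lower_bound_inter hh hK l hU hyU hyH hy, eventually_ne_atTop 0]
    with n hn hn0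
  have hprob := isProbabilityMeasure_sampleMeanLaw (P := P) hh n
  have hpos : 0 < (sampleMeanLaw P h n).real (supportingHalfSpace P h l) :=
    ENNReal.toReal_pos (sampleMeanLaw_supportingHalfSpace_pos hh hK l hn0).ne' (measure_ne_top _ _)
  rw [cond_real_eq hB.measurableSet, inv_mul_eq_div, le_div_iff₀ hpos]
  refine le_trans ?_ hn
  refine (mul_le_mul_of_nonneg_left (sampleMeanLaw_supportingHalfSpace_le hh hK l n)
    (Real.exp_pos _).le).trans_eq ?_
  rw [← Real.exp_add]
  congr 1
  ring

theorem conditional_upper_bound (hh : Measurable h) (hK : ∀ x, ‖h x‖ ≤ K) (l : E) (F : Set E)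
    (α β : ℝ) (hF : IsClosed F) (hαβ : α < β)
    (hI : ∀ y ∈ F, (β : EReal) < conditionalRate (cramerRate P h) (supportingHalfSpace P h l) y) :
    ∀ᶠ n : ℕ in atTop, (cond (sampleMeanLaw P h n) (supportingHalfSpace P h l)).real F ≤
      Real.exp (-(n * α)) := by
  have hB := isClosed_supportingHalfSpace P h l
  set c : ℝ := inner ℝ l (canonicalMean P h l) - logPartition P h l with hc
  have hinf := iInf_cramerRate_supportingHalfSpace (P := P) hh hK l
  have hI' : ∀ y ∈ supportingHalfSpace P h l ∩ F, ((β + c : ℝ) : EReal) < cramerRate P h y := by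
    rintro y ⟨hyH, hyF⟩
    have := (hI y hyF).not_ge
    rw [conditionalRate_le_coe_iff hB hinf] at this
    exact not_le.mp fun h => this ⟨hyH, h⟩
  -- half of the gap `β - α` is spent on the lower bound for the probability of the half-space
  have hlow := cramer_lower_bound_inter (P := P) hh hK l isOpen_univ (Set.mem_univ _)
    (canonicalMean_mem_supportingHalfSpace P h l) (r := c + (β - α) / 2)
    (by
      rw [cramerRate_canonicalMean hh hK l, EReal.coe_lt_coe_iff]
      linarith)
  filter_upwards [cramer_upper_bound hh hK _ ((α + β) / 2 + c) (β + c) (hB.inter hF)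
    (by linarith) hI', hlow] with n hn1 hn2
  rw [Set.inter_univ] at hn2
  have hpos := (Real.exp_pos _).trans_le hn2
  rw [cond_real_eq hB.measurableSet, inv_mul_eq_div, div_le_iff₀ hpos]
  refine hn1.trans (le_trans ?_ (mul_le_mul_of_nonneg_left hn2 (Real.exp_pos _).le))
  rw [← Real.exp_add]
  refine Real.exp_le_exp.mpr (le_of_eq ?_)
  ring

/-- The large deviation principle for sample means conditioned on a supporting half-space. -/
theorem satisfiesLDP_cond_sampleMeanLaw (hh : Measurable h) (hK : ∀ x, ‖h x‖ ≤ K) (l : E) :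
    SatisfiesLDP (fun n => (n : ℝ))
      (fun n => cond (sampleMeanLaw P h n) (supportingHalfSpace P h l))
      (conditionalRate (cramerRate P h) (supportingHalfSpace P h l)) :=
  have hB := isClosed_supportingHalfSpace P h l
  have hinf := iInf_cramerRate_supportingHalfSpace (P := P) hh hK l
  SatisfiesLDP.of_exp_bounds (conditionalRate_nonneg hB hinf)
    (lowerSemicontinuous_conditionalRate hB hinf (lowerSemicontinuous_cramerRate P h))
    (conditional_lower_bound hh hK l) (conditional_upper_bound hh hK l)

theorem conditionalRate_supportingHalfSpace_eq_zero_iff (hh : Measurable h) (hK : ∀ x, ‖h x‖ ≤ K)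
    (l a : E) : conditionalRate (cramerRate P h) (supportingHalfSpace P h l) a = 0 ↔
      a = canonicalMean P h l := by
  have hB := isClosed_supportingHalfSpace P h l
  have hinf := iInf_cramerRate_supportingHalfSpace (P := P) hh hK l
  have hiff := conditionalRate_le_coe_iff hB hinf (y := a) (r := 0)
  rw [EReal.coe_zero, zero_add] at hiff
  constructor
  · intro h0
    obtain ⟨haH, ha⟩ := hiff.mp h0.le
    refine eq_canonicalMean_of_cramerRate_le hh hK (ha.trans (EReal.coe_le_coe_iff.mpr ?_))
    rw [supportingHalfSpace, Set.mem_ofPred_eq, inner_sub_right] at haH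
    linarith
  · rintro rfl
    exact le_antisymm (hiff.mpr ⟨canonicalMean_mem_supportingHalfSpace P h l,
      (cramerRate_canonicalMean hh hK l).le⟩) (conditionalRate_nonneg hB hinf _)

theorem tendsto_cond_sampleMeanLaw_zero (hh : Measurable h) (hK : ∀ x, ‖h x‖ ≤ K) (l : E)
    {B : Set E} (hB : canonicalMean P h l ∉ closure B) :
    Tendsto (fun n => cond (sampleMeanLaw P h n) (supportingHalfSpace P h l) B) atTop (𝓝 0) := by
  have hH := isClosed_supportingHalfSpace P h l
  have hinf := iInf_cramerRate_supportingHalfSpace (P := P) hh hK l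
  have h1 := tendsto_measureReal_zero_of_upper_bound
    (isGoodRate_conditionalRate hH hinf (isGoodRate_cramerRate hh hK))
    (lowerSemicontinuous_conditionalRate hH hinf (lowerSemicontinuous_cramerRate P h))
    (conditional_upper_bound hh hK l) isClosed_closure (F := closure B) fun y hy =>
      (conditionalRate_nonneg hH hinf y).lt_of_ne fun h0 => hB <|
        (conditionalRate_supportingHalfSpace_eq_zero_iff hh hK l y).mp h0.symm ▸ hy
  have h2 := (ENNReal.tendsto_toReal_zero_iff fun n => measure_ne_top _ _).mp h1
  exact tendsto_of_tendsto_of_tendsto_of_le_of_le tendsto_const_nhds h2 (fun _ => zero_le)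
    fun _ => measure_mono subset_closure

theorem tendsto_cond_sampleMeanLaw_one (hh : Measurable h) (hK : ∀ x, ‖h x‖ ≤ K) (l : E)
    {B : Set E} (hBm : MeasurableSet B) (hB : canonicalMean P h l ∈ interior B) :
    Tendsto (fun n => cond (sampleMeanLaw P h n) (supportingHalfSpace P h l) B) atTop (𝓝 1) := by
  have h0 := tendsto_cond_sampleMeanLaw_zero (P := P) (B := Bᶜ) hh hK l
    (by rw [closure_compl]; exact fun hn => hn hB)
  have h1 := ENNReal.Tendsto.sub (tendsto_const_nhds (x := (1 : ENNReal))) h0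
    (.inl ENNReal.one_ne_top)
  rw [tsub_zero] at h1
  refine h1.congr' ?_
  filter_upwards [eventually_ne_atTop 0] with n hn
  have hprob := isProbabilityMeasure_sampleMeanLaw (P := P) hh n
  have hcond := cond_isProbabilityMeasure
    (sampleMeanLaw_supportingHalfSpace_pos (P := P) hh hK l hn).ne'
  rw [← prob_compl_eq_one_sub hBm.compl, compl_compl]

end ConditionalCramer

/-! ### Covariances and injectivity of the canonical mean -/

section CovarianceOperator

variable {X E : Type*} [MeasurableSpace X] [NormedAddCommGroup E] [InnerProductSpace ℝ E]
  [FiniteDimensional ℝ E] [MeasurableSpace E] [BorelSpace E] {P : Measure X}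
  [IsProbabilityMeasure P] {h : X → E} {K : ℝ}

theorem differentiable_canonicalMean (hh : Measurable h) (hK : ∀ x, ‖h x‖ ≤ K) :
    Differentiable ℝ (canonicalMean P h) := fun l =>
  ((hasFDerivAt_partitionFn hh hK l).differentiableAt.inv (partitionFn_pos hh hK l).ne').smul
    (hasFDerivAt_integral_exp_inner_smul hh hK hh.aestronglyMeasurable hK l).differentiableAt

theorem inner_fderiv_canonicalMean (hh : Measurable h) (hK : ∀ x, ‖h x‖ ≤ K) (l u v : E) :
    inner ℝ u (fderiv ℝ (canonicalMean P h) l v) =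
      (∫ x, inner ℝ u (h x) * inner ℝ v (h x) * Real.exp (inner ℝ l (h x)) ∂P) /
          partitionFn P h l -
        (∫ x, inner ℝ u (h x) * Real.exp (inner ℝ l (h x)) ∂P) *
          (∫ x, inner ℝ v (h x) * Real.exp (inner ℝ l (h x)) ∂P) / partitionFn P h l ^ 2 := by
  have hZ := (partitionFn_pos (P := P) hh hK l).ne'
  have hmean := hasFDerivAt_integral_exp_inner_smul (P := P) hh hK hh.aestronglyMeasurable hK l
  have hinv := (hasDerivAt_inv hZ).comp_hasFDerivAt l (hasFDerivAt_partitionFn (P := P) hh hK l)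
  have hint := integrable_exp_inner_smul (P := P) hh hK hh.aestronglyMeasurable hK l
  have hop : Integrable
      (fun x => Real.exp (inner ℝ l (h x)) • (innerSL ℝ (h x)).smulRight (h x)) P := by
    have hmeas : AEStronglyMeasurable (fun x => (innerSL ℝ (h x)).smulRight (h x)) P :=
      ((ContinuousLinearMap.smulRightL ℝ E E).continuous₂.comp
        ((innerSL ℝ).continuous.prodMk continuous_id)).comp_aestronglyMeasurable
        hh.aestronglyMeasurable
    refine integrable_exp_inner_smul (M := K * K) hh hK hmeas (fun x => ?_) l
    rw [ContinuousLinearMap.norm_smulRight_apply, innerSL_apply_norm]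
    exact mul_le_mul (hK x) (hK x) (norm_nonneg _) ((norm_nonneg _).trans (hK x))
  have hinner : ∀ w : E, inner ℝ w (∫ x, Real.exp (inner ℝ l (h x)) • h x ∂P) =
      ∫ x, inner ℝ w (h x) * Real.exp (inner ℝ l (h x)) ∂P := fun w => by
    rw [← integral_inner hint]
    simp only [inner_smul_right, mul_comm]
  have hop_inner : inner ℝ u ((∫ x, Real.exp (inner ℝ l (h x)) •
      (innerSL ℝ (h x)).smulRight (h x) ∂P) v) =
      ∫ x, inner ℝ u (h x) * inner ℝ v (h x) * Real.exp (inner ℝ l (h x)) ∂P := by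
    rw [ContinuousLinearMap.integral_apply hop, ← integral_inner (hop.apply_continuousLinearMap v)]
    refine integral_congr_ae (Eventually.of_forall fun x => ?_)
    change inner ℝ u (Real.exp (inner ℝ l (h x)) • (inner ℝ (h x) v • h x)) = _
    rw [inner_smul_right, inner_smul_right, real_inner_comm v (h x)]
    ring
  have hderiv : fderiv ℝ (canonicalMean P h) l = _ := (hinv.smul hmean).fderiv
  rw [hderiv]
  have h1 : inner ℝ (∫ x, Real.exp (inner ℝ l (h x)) • h x ∂P) v =
      ∫ x, inner ℝ v (h x) * Real.exp (inner ℝ l (h x)) ∂P := by rw [real_inner_comm, hinner]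
  simp only [Function.comp_apply, add_apply, smul_apply,
    ContinuousLinearMap.smulRight_apply, inner_add_right, inner_smul_right, hop_inner, hinner,
    innerSL_apply_apply, h1, smul_eq_mul]
  field_simp
  ring

/-- The derivative of the canonical mean is the covariance operator of `h` under the canonical
distribution. -/
theorem inner_fderiv_canonicalMean_eq_covariance (hh : Measurable h) (hK : ∀ x, ‖h x‖ ≤ K)
    (l u v : E) : inner ℝ u (fderiv ℝ (canonicalMean P h) l v) =
      covariance (fun x => inner ℝ u (h x)) (fun x => inner ℝ v (h x))
        (P.tilted fun x => inner ℝ l (h x)) := by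
  have hQ := isProbabilityMeasure_tilted_inner (P := P) hh hK l
  have hmem : ∀ w : E, MemLp (fun x => inner ℝ w (h x)) 2 (P.tilted fun x => inner ℝ l (h x)) :=
    fun w => MemLp.of_bound (measurable_const.inner hh).aestronglyMeasurable (‖w‖ * K)
      (Eventually.of_forall fun x => inner_le_of_norm_le hK w x)
  rw [covariance_eq_sub (hmem u) (hmem v), inner_fderiv_canonicalMean hh hK]
  simp only [integral_tilted_inner, Pi.mul_apply, smul_eq_mul, mul_comm (Real.exp _)]
  field_simp

theorem fderiv_canonicalMean_eq_zero (hh : Measurable h) (hK : ∀ x, ‖h x‖ ≤ K) {v : E} {c : ℝ}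
    (hv : ∀ᵐ x ∂P, inner ℝ v (h x) = c) (l : E) : fderiv ℝ (canonicalMean P h) l v = 0 := by
  refine ext_inner_left ℝ fun u => ?_
  have hQ := isProbabilityMeasure_tilted_inner (P := P) hh hK l
  have hv' := (tilted_absolutelyContinuous P fun x => inner ℝ l (h x)).ae_le hv
  rw [inner_zero_right, inner_fderiv_canonicalMean_eq_covariance hh hK, covariance]
  have hmean : ∫ x, inner ℝ v (h x) ∂(P.tilted fun x => inner ℝ l (h x)) = c := by
    rw [integral_congr_ae hv']
    simp
  refine integral_eq_zero_of_ae ?_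
  filter_upwards [hv'] with x hx
  simp [hmean, hx]

theorem ae_inner_eq_of_canonicalMean_eq (hh : Measurable h) (hK : ∀ x, ‖h x‖ ≤ K) {l m : E}
    (hlm : canonicalMean P h l = canonicalMean P h m) :
    ∀ᵐ x ∂P, inner ℝ (m - l) (h x) = inner ℝ (m - l) (canonicalMean P h l) :=
  ae_inner_eq_of_inner_canonicalMean_le hh hK (by rw [add_sub_cancel, hlm])

/-- A single nondegenerate derivative makes the canonical mean injective: equal means at `l ≠ m`
force `⟪m - l, h⟫` to be almost surely constant, and then every derivative vanishes at `m - l`. -/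
theorem injective_canonicalMean (hh : Measurable h) (hK : ∀ x, ‖h x‖ ≤ K) {l₀ : E}
    (hl₀ : ∀ v, fderiv ℝ (canonicalMean P h) l₀ v = 0 → v = 0) :
    Function.Injective (canonicalMean P h) := fun l m hlm =>
  (sub_eq_zero.mp (hl₀ (m - l) (fderiv_canonicalMean_eq_zero hh hK
    (ae_inner_eq_of_canonicalMean_eq hh hK hlm) l₀))).symm

/-- Parameters with equal canonical means define the same canonical distribution. -/
theorem tilted_eq_of_canonicalMean_eq (hh : Measurable h) (hK : ∀ x, ‖h x‖ ≤ K) {l m : E}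
    (hlm : canonicalMean P h l = canonicalMean P h m) :
    (P.tilted fun x => inner ℝ m (h x)) = P.tilted fun x => inner ℝ l (h x) := by
  have hQ := isProbabilityMeasure_tilted_inner (P := P) hh hK l
  have h1 : (fun x => inner ℝ m (h x)) =ᵐ[P] (fun x => inner ℝ l (h x)) +
      fun _ => inner ℝ (m - l) (canonicalMean P h l) := by
    filter_upwards [ae_inner_eq_of_canonicalMean_eq hh hK hlm] with x hx
    rw [inner_sub_left] at hx
    simp only [Pi.add_apply]
    linarith
  rw [tilted_congr h1, ← tilted_tilted (integrable_exp_inner hh hK l), tilted_const]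

theorem canonicalMean_eq_of_ae_eq_const (hh : Measurable h) (hK : ∀ x, ‖h x‖ ≤ K) {c : E}
    (hc : ∀ᵐ x ∂P, h x = c) (l : E) : canonicalMean P h l = c := by
  have hQ := isProbabilityMeasure_tilted_inner (P := P) hh hK l
  rw [canonicalMean_eq_integral_tilted, integral_congr_ae
    ((tilted_absolutelyContinuous P fun x => inner ℝ l (h x)).ae_le hc)]
  simp

end CovarianceOperator

/-! ### The pair of observables at times `0` and `t` -/

section Pair

open WithLp

variable {X : Type*} {d : ℕ}

/-- The pair of microscopic observables at times `0` and `t`, with values in the Hilbert sum. -/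
def pairObservable (g : X → MacroSpace d) (φ : ℝ → X → X) (t : ℝ) (x : X) :
    WithLp 2 (MacroSpace d × MacroSpace d) :=
  toLp 2 (g x, g (φ t x))

theorem inner_pairObservable (g : X → MacroSpace d) (φ : ℝ → X → X) (t : ℝ) (l₁ l₂ : MacroSpace d)
    (x : X) : inner ℝ (toLp 2 (l₁, l₂)) (pairObservable g φ t x) =
      inner ℝ l₁ (g x) + inner ℝ l₂ (g (φ t x)) :=
  prod_inner_apply _ _

theorem norm_pairObservable_le {g : X → MacroSpace d} {K : ℝ} (hK : ∀ x, ‖g x‖ ≤ K)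
    (φ : ℝ → X → X) (t : ℝ) (x : X) : ‖pairObservable g φ t x‖ ≤ K + K := by
  have h1 : pairObservable g φ t x = toLp 2 (g x, 0) + toLp 2 (0, g (φ t x)) := by
    rw [← toLp_add]; simp [pairObservable]
  rw [h1]
  refine (norm_add_le _ _).trans ?_
  rw [norm_toLp_fst, norm_toLp_snd]
  exact add_le_add (hK _) (hK _)

theorem sampleMean_pairObservable (g : X → MacroSpace d) (φ : ℝ → X → X) (t : ℝ) (n : ℕ)
    (x : Fin n → X) : sampleMean (pairObservable g φ t) n x =
      toLp 2 (empiricalAverage g n x, evolvedAverage g φ t n x) := by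
  have h1 : sampleMean (pairObservable g φ t) n x = (WithLp.linearEquiv 2 ℝ _).symm
      ((n : ℝ)⁻¹ • ∑ i, (g (x i), g (φ t (x i)))) := by
    simp only [sampleMean, map_smul, map_sum]
    rfl
  rw [h1]
  refine congrArg (toLp 2) (Prod.ext ?_ ?_)
  · simp only [Prod.smul_fst, Prod.fst_sum]
    rfl
  · simp only [Prod.smul_snd, Prod.snd_sum]
    rfl

variable [MeasurableSpace X]

theorem measurable_pairObservable {g : X → MacroSpace d} (hg : Measurable g) {φ : ℝ → X → X}
    (hφ : ∀ t, Measurable (φ t)) (t : ℝ) : Measurable (pairObservable g φ t) :=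
  (prod_continuous_toLp 2 (MacroSpace d) (MacroSpace d)).measurable.comp
    (hg.prodMk (hg.comp (hφ t)))

end Pair

/-! ### The noninteracting system in terms of the pair of observables -/

section Transfer

open WithLp

variable {X : Type*} [MeasurableSpace X] {d : ℕ}

theorem jointLaw_eq (P : Measure X) {g : X → MacroSpace d} {φ : ℝ → X → X} (hg : Measurable g) (hφ : ∀ t, Measurable (φ t)) (t : ℝ) (n : ℕ) :
    jointLaw P g φ t n = (sampleMeanLaw P (pairObservable g φ t) n).map
      (homeomorphProd 2 (MacroSpace d) (MacroSpace d)) := by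
  rw [sampleMeanLaw, Measure.map_map (homeomorphProd 2 _ _).continuous.measurable
    (measurable_sampleMean (measurable_pairObservable hg hφ t) n)]
  refine congrArg (fun f => Measure.map f (productMeasure P n)) (funext fun x => ?_)
  rw [Function.comp_apply, sampleMean_pairObservable]
  rfl

variable {P : Measure X} [IsProbabilityMeasure P] {g : X → MacroSpace d} {K : ℝ} {φ : ℝ → X → X}

theorem dynamicPartition_eq (P : Measure X) [IsProbabilityMeasure P] (g : X → MacroSpace d)
    (φ : ℝ → X → X) (t : ℝ) (l₁ l₂ : MacroSpace d) (n : ℕ) :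
    dynamicPartition (fun n => (n : ℝ)) (productMeasure P) (empiricalAverage g)
      (evolvedAverage g φ t) l₁ l₂ n =
      partitionFn P (pairObservable g φ t) (toLp 2 (l₁, l₂)) ^ n := by
  rw [← integral_exp_natCast_mul_inner_sampleMean]
  simp only [sampleMean_pairObservable]
  rfl

theorem tendsto_log_dynamicPartition (P : Measure X) [IsProbabilityMeasure P]
    (g : X → MacroSpace d) (φ : ℝ → X → X) (t : ℝ) (l₁ l₂ : MacroSpace d) :
    Tendsto (fun n : ℕ => (n : ℝ)⁻¹ * Real.log (dynamicPartition (fun n => (n : ℝ))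
        (productMeasure P) (empiricalAverage g) (evolvedAverage g φ t) l₁ l₂ n)) atTop
      (𝓝 (logPartition P (pairObservable g φ t) (toLp 2 (l₁, l₂)))) := by
  refine tendsto_const_nhds.congr' ?_
  filter_upwards [eventually_ne_atTop 0] with n hn
  rw [dynamicPartition_eq, Real.log_pow, inv_mul_cancel_left₀ (Nat.cast_ne_zero.mpr hn)]
  rfl

theorem noninteractingFreeEnergy_eq (P : Measure X) [IsProbabilityMeasure P]
    (g : X → MacroSpace d) (φ : ℝ → X → X) (t : ℝ) (l₁ l₂ : MacroSpace d) :
    noninteractingFreeEnergy P g φ t l₁ l₂ =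
      logPartition P (pairObservable g φ t) (toLp 2 (l₁, l₂)) :=
  (tendsto_log_dynamicPartition P g φ t l₁ l₂).limUnder_eq

theorem dynamicRate_eq (P : Measure X) [IsProbabilityMeasure P] (g : X → MacroSpace d)
    (φ : ℝ → X → X) (t : ℝ) : dynamicRate (noninteractingFreeEnergy P g φ t) =
      cramerRate P (pairObservable g φ t) ∘ (homeomorphProd 2 (MacroSpace d) (MacroSpace d)).symm := by
  funext a
  refine le_antisymm (iSup₂_le fun l₁ l₂ => ?_) (iSup_le fun l => ?_)
  · rw [noninteractingFreeEnergy_eq]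
    exact le_cramerRate P (pairObservable g φ t) (toLp 2 (l₁, l₂)) (toLp 2 a)
  · refine le_trans (le_of_eq ?_) (le_iSup₂ l.fst l.snd)
    rw [noninteractingFreeEnergy_eq]
    rfl

theorem hasFDerivAt_pair (hg : Measurable g) (hK : ∀ x, ‖g x‖ ≤ K) (hφ : ∀ t, Measurable (φ t))
    (t : ℝ) (l₁ l₂ : MacroSpace d) :
    HasFDerivAt (fun p : MacroSpace d × MacroSpace d => noninteractingFreeEnergy P g φ t p.1 p.2)
      ((innerSL ℝ (canonicalMean P (pairObservable g φ t) (toLp 2 (l₁, l₂)))).comp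
        (prodContinuousLinearEquiv 2 ℝ (MacroSpace d) (MacroSpace d)).symm.toContinuousLinearMap)
      (l₁, l₂) := by
  have h1 := (hasGradientAt_logPartition (P := P) (measurable_pairObservable hg hφ t)
    (norm_pairObservable_le hK φ t) (toLp 2 (l₁, l₂))).hasFDerivAt
  have h2 := HasFDerivAt.comp (l₁, l₂) (f := fun p => toLp 2 p) h1
    (prodContinuousLinearEquiv 2 ℝ (MacroSpace d) (MacroSpace d)).symm.hasFDerivAt
  refine h2.congr_of_eventuallyEq (Eventually.of_forall fun p => ?_)
  exact noninteractingFreeEnergy_eq P g φ t p.1 p.2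

theorem partialGradient₁_eq (hg : Measurable g) (hK : ∀ x, ‖g x‖ ≤ K) (hφ : ∀ t, Measurable (φ t))
    (t : ℝ) (l₁ l₂ : MacroSpace d) :
    partialGradient₁ (noninteractingFreeEnergy P g φ t) l₁ l₂ =
      (canonicalMean P (pairObservable g φ t) (toLp 2 (l₁, l₂))).fst := by
  refine HasGradientAt.gradient ?_
  rw [hasGradientAt_iff_hasFDerivAt]
  have h1 := HasFDerivAt.comp (f := fun x => (x, l₂)) l₁ (hasFDerivAt_pair (P := P) hg hK hφ t l₁ l₂)
    (hasFDerivAt_prodMk_left l₁ l₂)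
  refine HasFDerivAt.congr_fderiv h1 ?_
  ext v
  change inner ℝ (canonicalMean P (pairObservable g φ t) (toLp 2 (l₁, l₂))) (toLp 2 (v, 0)) = _
  rw [prod_inner_apply]
  simp

theorem partialGradient₂_eq (hg : Measurable g) (hK : ∀ x, ‖g x‖ ≤ K) (hφ : ∀ t, Measurable (φ t))
    (t : ℝ) (l₁ l₂ : MacroSpace d) :
    partialGradient₂ (noninteractingFreeEnergy P g φ t) l₁ l₂ =
      (canonicalMean P (pairObservable g φ t) (toLp 2 (l₁, l₂))).snd := by
  refine HasGradientAt.gradient ?_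
  rw [hasGradientAt_iff_hasFDerivAt]
  have h1 := HasFDerivAt.comp (f := fun x => (l₁, x)) l₂ (hasFDerivAt_pair (P := P) hg hK hφ t l₁ l₂)
    (hasFDerivAt_prodMk_right l₁ l₂)
  refine HasFDerivAt.congr_fderiv h1 ?_
  ext v
  change inner ℝ (canonicalMean P (pairObservable g φ t) (toLp 2 (l₁, l₂))) (toLp 2 (0, v)) = _
  rw [prod_inner_apply]
  simp

theorem partitionFn_pairObservable_zero (P : Measure X) (g : X → MacroSpace d) (φ : ℝ → X → X)
    (t : ℝ) (l : MacroSpace d) :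
    partitionFn P (pairObservable g φ t) (toLp 2 (l, 0)) = partitionFn P g l := by
  simp only [partitionFn, inner_pairObservable, inner_zero_left, add_zero]

theorem partialGradient₁_zero (hg : Measurable g) (hK : ∀ x, ‖g x‖ ≤ K) (hφ : ∀ t, Measurable (φ t))
    (t : ℝ) (l : MacroSpace d) :
    partialGradient₁ (noninteractingFreeEnergy P g φ t) l 0 = canonicalMean P g l := by
  have hint := integrable_exp_inner_smul (P := P) (measurable_pairObservable hg hφ t)
    (norm_pairObservable_le hK φ t) (measurable_pairObservable hg hφ t).aestronglyMeasurable
    (norm_pairObservable_le hK φ t) (toLp 2 (l, 0))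
  rw [partialGradient₁_eq hg hK hφ, canonicalMean, smul_fst, fst_integral_withLp hint,
    partitionFn_pairObservable_zero]
  simp only [smul_fst, inner_pairObservable, inner_zero_left, add_zero]
  rfl

theorem partialGradient₂_zero (hg : Measurable g) (hK : ∀ x, ‖g x‖ ≤ K) (hφ : ∀ t, Measurable (φ t))
    (t : ℝ) (l : MacroSpace d) :
    partialGradient₂ (noninteractingFreeEnergy P g φ t) l 0 =
      (partitionFn P g l)⁻¹ • ∫ x, Real.exp (inner ℝ l (g x)) • g (φ t x) ∂P := by
  have hint := integrable_exp_inner_smul (P := P) (measurable_pairObservable hg hφ t)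
    (norm_pairObservable_le hK φ t) (measurable_pairObservable hg hφ t).aestronglyMeasurable
    (norm_pairObservable_le hK φ t) (toLp 2 (l, 0))
  rw [partialGradient₂_eq hg hK hφ, canonicalMean, smul_snd, snd_integral_withLp hint,
    partitionFn_pairObservable_zero]
  simp only [smul_snd, inner_pairObservable, inner_zero_left, add_zero]
  rfl

/-- The macroscopic map does not depend on the choice of the conjugate macrostate, because
conjugate macrostates of the same macrostate define the same canonical distribution. -/
theorem macroscopicMap_partialGradient₁ (hg : Measurable g) (hK : ∀ x, ‖g x‖ ≤ K)
    (hφ : ∀ t, Measurable (φ t)) (t : ℝ) (l : MacroSpace d) :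
    macroscopicMap (noninteractingFreeEnergy P g φ t)
        (partialGradient₁ (noninteractingFreeEnergy P g φ t) l 0) =
      partialGradient₂ (noninteractingFreeEnergy P g φ t) l 0 := by
  have hex : ∃ m, partialGradient₁ (noninteractingFreeEnergy P g φ t) m 0 =
      partialGradient₁ (noninteractingFreeEnergy P g φ t) l 0 := ⟨l, rfl⟩
  rw [macroscopicMap, dif_pos hex]
  have h1 := hex.choose_spec
  generalize hex.choose = m at h1 ⊢
  rw [partialGradient₁_zero hg hK hφ, partialGradient₁_zero hg hK hφ] at h1
  rw [partialGradient₂_zero hg hK hφ, partialGradient₂_zero hg hK hφ,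
    ← integral_tilted_inner P g m fun x => g (φ t x),
    ← integral_tilted_inner P g l fun x => g (φ t x), tilted_eq_of_canonicalMean_eq hg hK h1]

theorem canonicalMean_pairObservable (hg : Measurable g) (hK : ∀ x, ‖g x‖ ≤ K)
    (hφ : ∀ t, Measurable (φ t)) (t : ℝ) (l₁ l₂ : MacroSpace d) :
    canonicalMean P (pairObservable g φ t) (toLp 2 (l₁, l₂)) =
      toLp 2 (partialGradient₁ (noninteractingFreeEnergy P g φ t) l₁ l₂,
        partialGradient₂ (noninteractingFreeEnergy P g φ t) l₁ l₂) := by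
  rw [partialGradient₁_eq hg hK hφ, partialGradient₂_eq hg hK hφ]
  rfl

/-- The conditioning set corresponds to a supporting half-space for the pair of observables. -/
theorem preimage_conditioningSet (hg : Measurable g) (hK : ∀ x, ‖g x‖ ≤ K)
    (hφ : ∀ t, Measurable (φ t)) (t : ℝ) (l : MacroSpace d) :
    homeomorphProd 2 (MacroSpace d) (MacroSpace d) ⁻¹'
        conditioningSet l (partialGradient₁ (noninteractingFreeEnergy P g φ t) l 0) =
      supportingHalfSpace P (pairObservable g φ t) (toLp 2 (l, 0)) := by
  ext a
  rw [supportingHalfSpace, canonicalMean_pairObservable hg hK hφ]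
  simp only [Set.mem_ofPred_eq, prod_inner_apply, inner_zero_left, add_zero]
  rfl

end Transfer

/-! ### Transport along homeomorphisms -/

section HomeomorphTransport

variable {Y Y' : Type*} [TopologicalSpace Y] [TopologicalSpace Y']

theorem cond_map_homeomorph [MeasurableSpace Y] [BorelSpace Y] [MeasurableSpace Y'] [BorelSpace Y']
    (μ : Measure Y) (e : Y ≃ₜ Y') {B : Set Y'} (hB : MeasurableSet B) :
    cond (μ.map e) B = (cond μ (e ⁻¹' B)).map e := by
  have he := e.continuous.measurable
  ext A hA
  rw [Measure.map_apply he hA, cond_apply hB, cond_apply (he hB), Measure.map_apply he hB,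
    Measure.map_apply he (hB.inter hA), Set.preimage_inter]

theorem iInf_comp_homeomorph_symm (I : Y → EReal) (e : Y ≃ₜ Y') (B : Set Y') :
    ⨅ y ∈ B, (I ∘ e.symm) y = ⨅ y ∈ e ⁻¹' B, I y := by
  refine e.symm.toEquiv.iInf_congr fun y => ?_
  simp

theorem conditionalRate_comp_homeomorph_symm (I : Y → EReal) (e : Y ≃ₜ Y') (B : Set Y') :
    conditionalRate (I ∘ e.symm) B = conditionalRate I (e ⁻¹' B) ∘ e.symm := by
  funext y
  rw [Function.comp_apply, conditionalRate, conditionalRate, iInf_comp_homeomorph_symm,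
    ← e.preimage_closure]
  have h1 : e.symm y ∈ e ⁻¹' closure B ↔ y ∈ closure B := by simp
  by_cases hy : y ∈ closure B
  · rw [if_pos hy, if_pos (h1.mpr hy), Function.comp_apply]
  · rw [if_neg hy, if_neg (mt h1.mp hy)]

end HomeomorphTransport

theorem isConvexRate_comp_homeomorphProd_symm {d : ℕ}
    {I : WithLp 2 (MacroSpace d × MacroSpace d) → EReal} (hI : IsConvexRate I) :
    IsConvexRate (I ∘ (WithLp.homeomorphProd 2 (MacroSpace d) (MacroSpace d)).symm) :=
  fun _ ha _ hb _ _ hu hv huv => hI (x := (_, _)) ha (y := (_, _)) hb hu hv huv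

/-! ### The Jacobian matrix -/

section Jacobian

variable {X : Type*} [MeasurableSpace X] {P : Measure X} [IsProbabilityMeasure P] {d : ℕ}
  {g : X → MacroSpace d} {K : ℝ} {φ : ℝ → X → X}

theorem partialGradient₁_zero_eq_canonicalMean (hg : Measurable g) (hK : ∀ x, ‖g x‖ ≤ K)
    (hφ : ∀ t, Measurable (φ t)) (t : ℝ) :
    (fun l => partialGradient₁ (noninteractingFreeEnergy P g φ t) l 0) = canonicalMean P g :=
  funext fun l => partialGradient₁_zero hg hK hφ t l

theorem macroJacobian_eq_inner (hg : Measurable g) (hK : ∀ x, ‖g x‖ ≤ K)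
    (hφ : ∀ t, Measurable (φ t)) (t : ℝ) (l : MacroSpace d) (i j : Fin d) :
    macroJacobian (noninteractingFreeEnergy P g φ t) l i j =
      inner ℝ (EuclideanSpace.single i (1 : ℝ))
        (fderiv ℝ (canonicalMean P g) l (EuclideanSpace.single j (1 : ℝ))) := by
  rw [macroJacobian, Matrix.of_apply, partialGradient₁_zero_eq_canonicalMean hg hK hφ,
    EuclideanSpace.inner_single_left]
  simp

theorem macroJacobian_mulVec (hg : Measurable g) (hK : ∀ x, ‖g x‖ ≤ K)
    (hφ : ∀ t, Measurable (φ t)) (t : ℝ) (l v : MacroSpace d) :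
    (macroJacobian (noninteractingFreeEnergy P g φ t) l).mulVec v.ofLp =
      (fderiv ℝ (canonicalMean P g) l v).ofLp := by
  have hv : v = ∑ j, v j • EuclideanSpace.single j (1 : ℝ) := by
    ext i
    simp [Finset.sum_apply, Pi.single_apply]
  funext i
  conv_rhs => rw [hv, map_sum]
  simp only [Matrix.mulVec, dotProduct, macroJacobian_eq_inner hg hK hφ, map_smul]
  simp [mul_comm, EuclideanSpace.inner_single_left]

theorem injective_canonicalMean_of_det_ne_zero (hg : Measurable g) (hK : ∀ x, ‖g x‖ ≤ K)
    (hφ : ∀ t, Measurable (φ t)) (t : ℝ) {l : MacroSpace d}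
    (hdet : (macroJacobian (noninteractingFreeEnergy P g φ t) l).det ≠ 0) :
    Function.Injective (canonicalMean P g) := by
  refine injective_canonicalMean hg hK (l₀ := l) fun v hv => ?_
  have h1 := macroJacobian_mulVec (P := P) hg hK hφ t l v
  rw [hv] at h1
  exact (WithLp.ofLp_injective 2) (Matrix.eq_zero_of_mulVec_eq_zero hdet h1)

end Jacobian

/-! ### Indicator functions -/

section Indicator

variable {X : Type*}

theorem indicatorObservable_apply (C : Set X) (x : X) (i : Fin 1) :
    indicatorObservable C x i = C.indicator (fun _ => (1 : ℝ)) x := rfl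

theorem norm_indicatorObservable_le (C : Set X) (x : X) : ‖indicatorObservable C x‖ ≤ 1 := by
  rw [EuclideanSpace.norm_eq, Fin.sum_univ_one, Real.sqrt_sq (norm_nonneg _),
    indicatorObservable_apply]
  exact (norm_indicator_le_norm_self _ _).trans (by simp)

theorem inner_indicatorObservable (C : Set X) (l : MacroSpace 1) (x : X) :
    inner ℝ l (indicatorObservable C x) = l 0 * C.indicator (fun _ => (1 : ℝ)) x := by
  rw [PiLp.inner_apply, Fin.sum_univ_one, indicatorObservable_apply]
  simp [mul_comm]

variable [MeasurableSpace X] {P : Measure X} [IsProbabilityMeasure P] {C : Set X}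

theorem measurable_indicatorObservable (hC : MeasurableSet C) :
    Measurable (indicatorObservable C) :=
  (PiLp.continuous_toLp 2 fun _ : Fin 1 => ℝ).measurable.comp
    (measurable_pi_lambda _ fun _ => measurable_const.indicator hC)

theorem partitionFn_indicatorObservable (hC : MeasurableSet C) (l : MacroSpace 1) :
    partitionFn P (indicatorObservable C) l = 1 - P.real C + Real.exp (l 0) * P.real C := by
  have h1 : ∀ x, Real.exp (inner ℝ l (indicatorObservable C x)) =
      1 + (Real.exp (l 0) - 1) * C.indicator (fun _ => (1 : ℝ)) x := fun x => by
    rw [inner_indicatorObservable]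
    by_cases hx : x ∈ C <;> simp [hx]
  have hint : Integrable (fun x => C.indicator (fun _ => (1 : ℝ)) x) P :=
    (integrable_const 1).indicator hC
  rw [partitionFn, integral_congr_ae (Eventually.of_forall h1),
    integral_add (integrable_const 1) (hint.const_mul _), integral_const_mul,
    integral_indicator_const _ hC]
  simp
  ring

theorem macroJacobian_indicatorObservable (hC : MeasurableSet C) {φ : ℝ → X → X}
    (hφ : ∀ t, Measurable (φ t)) (t : ℝ) (l : MacroSpace 1) :
    macroJacobian (noninteractingFreeEnergy P (indicatorObservable C) φ t) l 0 0 =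
      Real.exp (l 0) * P.real C * (1 - P.real C) /
        (1 - P.real C + Real.exp (l 0) * P.real C) ^ 2 := by
  have hm := measurable_indicatorObservable hC
  have hb := norm_indicatorObservable_le C
  have hZ := partitionFn_indicatorObservable (P := P) hC l
  have hpos := partitionFn_pos (P := P) hm hb l
  have hfirst : ∫ x, inner ℝ (EuclideanSpace.single 0 (1 : ℝ)) (indicatorObservable C x) *
      Real.exp (inner ℝ l (indicatorObservable C x)) ∂P = Real.exp (l 0) * P.real C := by
    have h1 : ∀ x, inner ℝ (EuclideanSpace.single 0 (1 : ℝ)) (indicatorObservable C x) *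
        Real.exp (inner ℝ l (indicatorObservable C x)) =
        C.indicator (fun _ => Real.exp (l 0)) x := fun x => by
      rw [inner_indicatorObservable, inner_indicatorObservable]
      by_cases hx : x ∈ C <;> simp [hx]
    rw [integral_congr_ae (Eventually.of_forall h1), integral_indicator_const _ hC, smul_eq_mul,
      mul_comm]
  have hsecond : ∫ x, inner ℝ (EuclideanSpace.single 0 (1 : ℝ)) (indicatorObservable C x) *
      inner ℝ (EuclideanSpace.single 0 (1 : ℝ)) (indicatorObservable C x) *
      Real.exp (inner ℝ l (indicatorObservable C x)) ∂P = Real.exp (l 0) * P.real C := by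
    rw [← hfirst]
    refine integral_congr_ae (Eventually.of_forall fun x => ?_)
    simp only [inner_indicatorObservable]
    by_cases hx : x ∈ C <;> simp [hx]
  rw [macroJacobian_eq_inner hm hb hφ, inner_fderiv_canonicalMean hm hb, hsecond, hfirst]
  rw [hZ] at hpos ⊢
  have := hpos.ne'
  field_simp
  ring

theorem macroJacobian_indicatorObservable_eq_zero_iff (hC : MeasurableSet C) {φ : ℝ → X → X}
    (hφ : ∀ t, Measurable (φ t)) (t : ℝ) (l : MacroSpace 1) :
    macroJacobian (noninteractingFreeEnergy P (indicatorObservable C) φ t) l 0 0 = 0 ↔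
      P C = 0 ∨ P C = 1 := by
  have hpos := partitionFn_pos (P := P) (measurable_indicatorObservable hC)
    (norm_indicatorObservable_le C) l
  rw [partitionFn_indicatorObservable hC] at hpos
  rw [macroJacobian_indicatorObservable hC hφ, div_eq_zero_iff, or_iff_left (pow_pos hpos 2).ne',
    mul_eq_zero, mul_eq_zero, or_iff_right (Real.exp_pos _).ne', sub_eq_zero, measureReal_def,
    ENNReal.toReal_eq_zero_iff, or_iff_left (measure_ne_top P C), eq_comm (a := (1 : ℝ)),
    ENNReal.toReal_eq_one_iff]

theorem exists_ae_indicatorObservable_eq (hC : MeasurableSet C) (h : P C = 0 ∨ P C = 1) :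
    ∃ c : MacroSpace 1, ∀ᵐ x ∂P, indicatorObservable C x = c := by
  rcases h with h | h
  · refine ⟨WithLp.toLp 2 fun _ => 0, ?_⟩
    filter_upwards [measure_eq_zero_iff_ae_notMem.mp h] with x hx
    simp [indicatorObservable, hx]
  · refine ⟨WithLp.toLp 2 fun _ => 1, ?_⟩
    filter_upwards [(mem_ae_iff_prob_eq_one hC).mpr h] with x hx
    simp [indicatorObservable, hx]

end Indicator

/-! ### Large deviations and the macroscopic map of the noninteracting system -/

theorem mainTheorem4 {X : Type*} [MeasurableSpace X] (P : Measure X) [IsProbabilityMeasure P]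
    (φ : ℝ → X → X) (hφ : ∀ t, Measurable (φ t))
    {d : ℕ} (hd : 0 < d) (g : X → MacroSpace d) (hg : Measurable g)
    (hbdd : ∃ K : ℝ, ∀ x, ‖g x‖ ≤ K) (t : ℝ) :
    let Ψ : MacroSpace d → MacroSpace d → ℝ := noninteractingFreeEnergy P g φ t
    let I : MacroSpace d × MacroSpace d → EReal := dynamicRate Ψ
    let μ : ℕ → Measure (MacroSpace d × MacroSpace d) := jointLaw P g φ t
    let Z : MacroSpace d → ℝ := canonicalPartition P g
    let J : MacroSpace d → Matrix (Fin d) (Fin d) ℝ := macroJacobian Ψ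
    -- the dynamic free energy is well defined, finite and given by the one-constituent integral
    (∀ l₁ l₂ : MacroSpace d,
      (∀ n : ℕ, Integrable (fun x => Real.exp ((n : ℝ) * (inner ℝ l₁ (empiricalAverage g n x) +
        inner ℝ l₂ (evolvedAverage g φ t n x)))) (productMeasure P n)) ∧
      Integrable (fun x => Real.exp (inner ℝ l₁ (g x) + inner ℝ l₂ (g (φ t x)))) P ∧
      0 < ∫ x, Real.exp (inner ℝ l₁ (g x) + inner ℝ l₂ (g (φ t x))) ∂P ∧
      Tendsto (fun n : ℕ => (n : ℝ)⁻¹ * Real.log (dynamicPartition (fun n => (n : ℝ))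
        (productMeasure P) (empiricalAverage g) (evolvedAverage g φ t) l₁ l₂ n)) atTop
        (𝓝 (Ψ l₁ l₂)) ∧
      Ψ l₁ l₂ = Real.log (∫ x, Real.exp (inner ℝ l₁ (g x) + inner ℝ l₂ (g (φ t x))) ∂P)) ∧
    -- it is differentiable, jointly in both variables
    Differentiable ℝ (fun p : MacroSpace d × MacroSpace d => Ψ p.1 p.2) ∧
    -- the large deviation principle, with its good convex rate function
    SatisfiesLDP (fun n => (n : ℝ)) μ I ∧ IsGoodRate I ∧ IsConvexRate I ∧
    (∀ l₁ l₂ : MacroSpace d,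
      I (partialGradient₁ Ψ l₁ l₂, partialGradient₂ Ψ l₁ l₂) =
        ((inner ℝ l₁ (partialGradient₁ Ψ l₁ l₂) + inner ℝ l₂ (partialGradient₂ Ψ l₁ l₂)
          - Ψ l₁ l₂ : ℝ) : EReal)) ∧
    -- for every macrostate `a₀` with a conjugate macrostate `l₀`:
    (∀ a₀ l₀ : MacroSpace d, a₀ = partialGradient₁ Ψ l₀ 0 →
      -- canonical averages
      a₀ = (Z l₀)⁻¹ • ∫ x, Real.exp (inner ℝ l₀ (g x)) • g x ∂P ∧
      macroscopicMap Ψ a₀ = partialGradient₂ Ψ l₀ 0 ∧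
      macroscopicMap Ψ a₀ = (Z l₀)⁻¹ • ∫ x, Real.exp (inner ℝ l₀ (g x)) • g (φ t x) ∂P ∧
      -- they are the limits of the canonical averages of the whole system
      Tendsto (fun n : ℕ =>
          (∫ x, Real.exp ((n : ℝ) * inner ℝ l₀ (empiricalAverage g n x)) ∂(productMeasure P n))⁻¹ •
          ∫ x, Real.exp ((n : ℝ) * inner ℝ l₀ (empiricalAverage g n x)) •
            empiricalAverage g n x ∂(productMeasure P n)) atTop (𝓝 a₀) ∧
      Tendsto (fun n : ℕ =>
          (∫ x, Real.exp ((n : ℝ) * inner ℝ l₀ (empiricalAverage g n x)) ∂(productMeasure P n))⁻¹ •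
          ∫ x, Real.exp ((n : ℝ) * inner ℝ l₀ (empiricalAverage g n x)) •
            evolvedAverage g φ t n x ∂(productMeasure P n)) atTop (𝓝 (macroscopicMap Ψ a₀)) ∧
      -- the conditional large deviation principle
      (∀ n : ℕ, 0 < n → 0 < μ n (conditioningSet l₀ a₀)) ∧
      (⨅ a ∈ conditioningSet l₀ a₀, I a) = ((inner ℝ l₀ a₀ - Ψ l₀ 0 : ℝ) : EReal) ∧
      SatisfiesLDP (fun n => (n : ℝ)) (fun n => cond (μ n) (conditioningSet l₀ a₀))
        (conditionalRate I (conditioningSet l₀ a₀)) ∧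
      IsGoodRate (conditionalRate I (conditioningSet l₀ a₀)) ∧
      IsConvexRate (conditionalRate I (conditioningSet l₀ a₀)) ∧
      -- the asymptotically most likely values are `a₀` and `ψ_t (a₀)`
      (∀ a : MacroSpace d × MacroSpace d,
        conditionalRate I (conditioningSet l₀ a₀) a = 0 ↔ a = (a₀, macroscopicMap Ψ a₀)) ∧
      (∀ B : Set (MacroSpace d × MacroSpace d), MeasurableSet B →
        ((a₀, macroscopicMap Ψ a₀) ∈ interior B →
          Tendsto (fun n => cond (μ n) (conditioningSet l₀ a₀) B) atTop (𝓝 1)) ∧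
        ((a₀, macroscopicMap Ψ a₀) ∉ closure B →
          Tendsto (fun n => cond (μ n) (conditioningSet l₀ a₀) B) atTop (𝓝 0)))) ∧
    -- the Jacobian of `l₀ ↦ a₀` is the canonical covariance matrix of `g`
    Differentiable ℝ (fun l => partialGradient₁ Ψ l 0) ∧
    (∀ (l : MacroSpace d) (i j : Fin d),
      J l i j = (∫ x, g x i * g x j * Real.exp (inner ℝ l (g x)) ∂P) / Z l
        - (∫ x, g x i * Real.exp (inner ℝ l (g x)) ∂P) *
          (∫ x, g x j * Real.exp (inner ℝ l (g x)) ∂P) / (Z l) ^ 2 ∧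
      J l i j = covariance (fun x => g x i) (fun x => g x j) (canonicalMeasure P g l)) ∧
    -- invertibility of `l₀ ↦ a₀`
    (∀ l : MacroSpace d, (J l).det ≠ 0 → Function.Injective fun l => partialGradient₁ Ψ l 0) ∧
    ((∃ c : MacroSpace d, ∀ᵐ x ∂P, g x = c) →
      (∀ l : MacroSpace d, J l = 0) ∧ ¬ Function.Injective fun l => partialGradient₁ Ψ l 0) ∧
    -- the case of an indicator function
    (∀ C : Set X, MeasurableSet C →
      (∀ l : MacroSpace 1,
        macroJacobian (noninteractingFreeEnergy P (indicatorObservable C) φ t) l 0 0 =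
          Real.exp (l 0) * P.real C * (1 - P.real C) /
            (1 - P.real C + Real.exp (l 0) * P.real C) ^ 2 ∧
        (macroJacobian (noninteractingFreeEnergy P (indicatorObservable C) φ t) l 0 0 = 0 ↔
          P C = 0 ∨ P C = 1)) ∧
      (P C = 0 ∨ P C = 1 → ∃ c : MacroSpace 1, ∀ᵐ x ∂P, indicatorObservable C x = c) ∧
      (¬ (P C = 0 ∨ P C = 1) → Function.Injective fun l =>
        partialGradient₁ (noninteractingFreeEnergy P (indicatorObservable C) φ t) l 0)) := by
  intro Ψ I μ Z J
  obtain ⟨K, hK⟩ := hbdd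
  have hpm := measurable_pairObservable hg hφ t
  have hpK := norm_pairObservable_le hK φ t
  set e := WithLp.homeomorphProd 2 (MacroSpace d) (MacroSpace d) with he
  have hI : I = cramerRate P (pairObservable g φ t) ∘ e.symm := dynamicRate_eq P g φ t
  have hμ : μ = fun n => (sampleMeanLaw P (pairObservable g φ t) n).map e :=
    funext fun n => jointLaw_eq P hg hφ t n
  have hΨ : ∀ l₁ l₂, Ψ l₁ l₂ = logPartition P (pairObservable g φ t) (WithLp.toLp 2 (l₁, l₂)) :=
    noninteractingFreeEnergy_eq P g φ t
  have hgrad : (fun l => partialGradient₁ Ψ l 0) = canonicalMean P g :=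
    partialGradient₁_zero_eq_canonicalMean hg hK hφ t
  refine ⟨fun l₁ l₂ => ⟨fun n => ?_, ?_, ?_, ?_, ?_⟩, ?_, ?_, ?_, ?_, fun l₁ l₂ => ?_, ?_, ?_,
    fun l i j => ⟨?_, ?_⟩, fun l hl => ?_, ?_, fun C hC => ⟨fun l => ⟨?_, ?_⟩, ?_, fun hP => ?_⟩⟩
  · have h1 := integrable_exp_natCast_mul_inner_sampleMean (P := P) hpm hpK
      (WithLp.toLp 2 (l₁, l₂)) n
    simp only [sampleMean_pairObservable] at h1
    exact h1
  · simpa only [inner_pairObservable] using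
      integrable_exp_inner (P := P) hpm hpK (WithLp.toLp 2 (l₁, l₂))
  · simpa only [partitionFn, inner_pairObservable] using
      partitionFn_pos (P := P) hpm hpK (WithLp.toLp 2 (l₁, l₂))
  · rw [hΨ]
    exact tendsto_log_dynamicPartition P g φ t l₁ l₂
  · rw [hΨ]
    simp only [logPartition, partitionFn, inner_pairObservable]
  · exact fun p => (hasFDerivAt_pair hg hK hφ t p.1 p.2).differentiableAt
  · rw [hI, hμ]
    exact (satisfiesLDP_sampleMeanLaw hpm hpK).map_homeomorph e
  · rw [hI]
    exact (isGoodRate_cramerRate hpm hpK).comp_homeomorph_symm e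
  · rw [hI]
    exact isConvexRate_comp_homeomorphProd_symm (isConvexRate_cramerRate P _)
  · have h1 := cramerRate_canonicalMean (P := P) hpm hpK (WithLp.toLp 2 (l₁, l₂))
    rw [canonicalMean_pairObservable hg hK hφ] at h1
    rw [hI, hΨ]
    exact h1
  · rintro a₀ l₀ rfl
    have hmap : macroscopicMap Ψ (partialGradient₁ Ψ l₀ 0) = partialGradient₂ Ψ l₀ 0 :=
      macroscopicMap_partialGradient₁ hg hK hφ t l₀
    have hg₁ : partialGradient₁ Ψ l₀ 0 = (Z l₀)⁻¹ • ∫ x, Real.exp (inner ℝ l₀ (g x)) • g x ∂P :=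
      partialGradient₁_zero hg hK hφ t l₀
    have hg₂ : partialGradient₂ Ψ l₀ 0 =
        (Z l₀)⁻¹ • ∫ x, Real.exp (inner ℝ l₀ (g x)) • g (φ t x) ∂P :=
      partialGradient₂_zero hg hK hφ t l₀
    have hmean : canonicalMean P (pairObservable g φ t) (WithLp.toLp 2 (l₀, 0)) =
        e.symm (partialGradient₁ Ψ l₀ 0, partialGradient₂ Ψ l₀ 0) :=
      canonicalMean_pairObservable hg hK hφ t l₀ 0
    set B₀ := conditioningSet l₀ (partialGradient₁ Ψ l₀ 0) with hB₀
    have hpre : e ⁻¹' B₀ = supportingHalfSpace P (pairObservable g φ t) (WithLp.toLp 2 (l₀, 0)) :=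
      preimage_conditioningSet hg hK hφ t l₀
    have hclosed := isClosed_supportingHalfSpace P (pairObservable g φ t) (WithLp.toLp 2 (l₀, 0))
    have hinf := iInf_cramerRate_supportingHalfSpace (P := P) hpm hpK (WithLp.toLp 2 (l₀, 0))
    have hB₀m : MeasurableSet B₀ := 
      (e.isClosed_preimage.mp (hpre ▸ hclosed)).measurableSet
    have hrate : conditionalRate I B₀ = conditionalRate (cramerRate P (pairObservable g φ t))
        (supportingHalfSpace P (pairObservable g φ t) (WithLp.toLp 2 (l₀, 0))) ∘ e.symm := by
      rw [hI, conditionalRate_comp_homeomorph_symm, hpre]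
    have hcond : (fun n => cond (μ n) B₀) = fun n =>
        (cond (sampleMeanLaw P (pairObservable g φ t) n)
          (supportingHalfSpace P (pairObservable g φ t) (WithLp.toLp 2 (l₀, 0)))).map e := by
      funext n
      rw [hμ, cond_map_homeomorph _ e hB₀m, hpre]
    refine ⟨hg₁, hmap, hmap.trans hg₂, ?_, ?_, fun n hn => ?_, ?_, ?_, ?_, ?_, fun a => ?_,
      fun B hB => ⟨fun hmem => ?_, fun hmem => ?_⟩⟩
    · rw [hg₁]
      refine tendsto_const_nhds.congr' ?_
      filter_upwards [eventually_ne_atTop 0] with n hn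
      exact (canonical_average_sampleMean hg hK hg.stronglyMeasurable hK l₀ hn).symm
    · rw [hmap, hg₂]
      refine tendsto_const_nhds.congr' ?_
      filter_upwards [eventually_ne_atTop 0] with n hn
      exact (canonical_average_sampleMean hg hK (hg.comp (hφ t)).stronglyMeasurable
        (fun x => hK (φ t x)) l₀ hn).symm
    · rw [hμ, Measure.map_apply e.continuous.measurable hB₀m, hpre]
      exact sampleMeanLaw_supportingHalfSpace_pos hpm hpK _ hn.ne'
    · rw [hI, iInf_comp_homeomorph_symm, hpre, hinf, hΨ, hmean]
      congr 2
      refine (WithLp.prod_inner_apply _ _).trans ?_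
      rw [inner_zero_left, add_zero]
      rfl
    · rw [hcond, hrate]
      exact (satisfiesLDP_cond_sampleMeanLaw hpm hpK _).map_homeomorph e
    · rw [hrate]
      exact (isGoodRate_conditionalRate hclosed hinf
        (isGoodRate_cramerRate hpm hpK)).comp_homeomorph_symm e
    · rw [hrate]
      exact isConvexRate_comp_homeomorphProd_symm (isConvexRate_conditionalRate hclosed
        (convex_supportingHalfSpace P _ _) hinf (isConvexRate_cramerRate P _))
    · rw [hrate, Function.comp_apply,
        conditionalRate_supportingHalfSpace_eq_zero_iff hpm hpK, hmean, hmap]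
      exact e.symm.injective.eq_iff
    · rw [hmap] at hmem
      have h1 := tendsto_cond_sampleMeanLaw_one (P := P) (B := e ⁻¹' B) hpm hpK
        (WithLp.toLp 2 (l₀, 0)) (e.continuous.measurable hB)
        (by rw [← e.preimage_interior, hmean]; simpa using hmem)
      have h2 : ∀ n, cond (μ n) B₀ B = cond (sampleMeanLaw P (pairObservable g φ t) n)
          (supportingHalfSpace P (pairObservable g φ t) (WithLp.toLp 2 (l₀, 0))) (e ⁻¹' B) :=
        fun n => by rw [congrFun hcond n, Measure.map_apply e.continuous.measurable hB]
      simpa only [h2] using h1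
    · rw [hmap] at hmem
      have h1 := tendsto_cond_sampleMeanLaw_zero (P := P) (B := e ⁻¹' B) hpm hpK
        (WithLp.toLp 2 (l₀, 0))
        (by rw [← e.preimage_closure, hmean]; simpa using hmem)
      have h2 : ∀ n, cond (μ n) B₀ B = cond (sampleMeanLaw P (pairObservable g φ t) n)
          (supportingHalfSpace P (pairObservable g φ t) (WithLp.toLp 2 (l₀, 0))) (e ⁻¹' B) :=
        fun n => by rw [congrFun hcond n, Measure.map_apply e.continuous.measurable hB]
      simpa only [h2] using h1
  · rw [hgrad]
    exact differentiable_canonicalMean hg hK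
  · have h1 := macroJacobian_eq_inner (P := P) hg hK hφ t l i j
    rw [inner_fderiv_canonicalMean hg hK] at h1
    simp only [EuclideanSpace.inner_single_left, map_one, one_mul] at h1
    exact h1
  · have h1 := macroJacobian_eq_inner (P := P) hg hK hφ t l i j
    rw [inner_fderiv_canonicalMean_eq_covariance hg hK] at h1
    simp only [EuclideanSpace.inner_single_left, map_one, one_mul] at h1
    exact h1
  · rw [hgrad]
    exact injective_canonicalMean_of_det_ne_zero hg hK hφ t hl
  · rintro ⟨c, hc⟩
    refine ⟨fun l => ?_, fun hinj => ?_⟩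
    · ext i j
      refine (macroJacobian_eq_inner (P := P) hg hK hφ t l i j).trans ?_
      rw [fderiv_canonicalMean_eq_zero hg hK
        (c := inner ℝ (EuclideanSpace.single j (1 : ℝ)) c) (hc.mono fun x hx => by rw [hx]),
        inner_zero_right, Matrix.zero_apply]
    · rw [hgrad] at hinj
      have h1 : (0 : MacroSpace d) = EuclideanSpace.single (⟨0, hd⟩ : Fin d) (1 : ℝ) :=
        hinj ((canonicalMean_eq_of_ae_eq_const hg hK hc _).trans
          (canonicalMean_eq_of_ae_eq_const hg hK hc _).symm)
      simpa using congrArg (fun v : MacroSpace d => v ⟨0, hd⟩) h1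
  · exact macroJacobian_indicatorObservable hC hφ t l
  · exact macroJacobian_indicatorObservable_eq_zero_iff hC hφ t l
  · exact exists_ae_indicatorObservable_eq hC
  · have hm := measurable_indicatorObservable hC
    have hb := norm_indicatorObservable_le C
    rw [partialGradient₁_zero_eq_canonicalMean hm hb hφ]
    refine injective_canonicalMean_of_det_ne_zero hm hb hφ t (l := 0) ?_
    rw [Matrix.det_fin_one]
    exact mt (macroJacobian_indicatorObservable_eq_zero_iff hC hφ t 0).mp hP
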